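/- Call a partial function $F:\subseteq\mathbb{N}^{\mathbb{N}}\to\mathbb{N}^{\mathbb{N}}$ computable if it is computed by an oracle (Type-2) machine, that is, if there is one program that on input $n$ with oracle $p$ outputs the $n$-th term of $F(p)$, where $p\in\mathrm{dom}(F)$ if and only if the program halts for all $n$. A representation of a set $X$ is a surjective partial function $\sigma_X:\subseteq\mathbb{N}^{\mathbb{N}}\to X$; the $p$ with $\sigma_X(p)=x$ are the names of $x$. A realizer of a partial multi-valued function $f:\subseteq X\rightrightarrows Y$ between represented spaces is a partial function $G:\subseteq\mathbb{N}^{\mathbb{N}}\to\mathbb{N}^{\mathbb{N}}$ that maps every name of every $x\in\mathrm{dom}(f)$ to a name of some element of $f(x)$. We write $f\le_{\mathrm{sW}}g$ (strong Weihrauch reducibility) if there are computable $H,K:\subseteq\mathbb{N}^{\mathbb{N}}\to\mathbb{N}^{\mathbb{N}}$ such that $H\circ G\circ K$ is a realizer of $f$ for every realizer $G$ of $g$, and $f\equiv_{\mathrm{sW}}g$ if $f\le_{\mathrm{sW}}g$ and $g\le_{\mathrm{sW}}f$. For $n\ge1$ equip $\mathbb{R}^n$ with the Euclidean metric $d$ and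 fix an effective enumeration $(\alpha_k)_{k}$ of $\mathbb{Q}^n$. Points $x\in\mathbb{R}^n$ are represented by $p\in\mathbb{N}^{\mathbb{N}}$ with $d(\alpha_{p(i)},\alpha_{p(j)})\le2^{-i}$ for all $i\le j$ and $\lim_i\alpha_{p(i)}=x$. Closed sets $A\subseteq\mathbb{R}^n$ are represented by negative information: $p$ is a name of $A$ if $A=\mathbb{R}^n\setminus\bigcup_{i\in\mathbb{N}}B_{p(i)}$, where $(B_k)_k$ is the effective enumeration of all open balls with centre in $\mathbb{Q}^n$ and nonnegative rational radius (radius $0$ gives the empty ball). Pairs are represented by interleaving names. Closed choice $\mathrm{C}_{\mathbb{R}}$ maps a nonempty closed $A\subseteq\mathbb{R}$, given by negative information, to an arbitrary point of $A$. For $\varepsilon>0$, the $\varepsilon$-approximate negative closed projection operator $\varepsilon\text{-}\mathrm{Proj}^-_{\mathbb{R}^n}$ maps $(x,A)$, where $x\in\mathbb{R}^n$ and $A\subseteq\mathbb{R}^n$ is nonempty, closed and given by negative information, to an arbitrary $y\in A$ with $d(x,y)\le(1+\varepsilon)\,d(x,A)$. Theorem. For every real $\varepsilon>0$ and every integer $n\ge1$,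 $\varepsilon\text{-}\mathrm{Proj}^-_{\mathbb{R}^n}\equiv_{\mathrm{sW}}\mathrm{C}_{\mathbb{R}}$. -/

import Mathlib

open scoped Topology

namespace Weih

/-! ### Machines with an infinite input and an infinite output -/

/-- Points of Baire space `ℕ^ℕ`. -/
abbrev Baire : Type := ℕ → ℕ

/-- Programs of oracle machines: the programs for partial recursive functions together with one
instruction that queries the infinite input. -/
inductive OracleCode : Type
  | zero : OracleCode
  | succ : OracleCode
  | left : OracleCode
  | right : OracleCode
  | oracle : OracleCode
  | pair : OracleCode → OracleCode → OracleCode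
  | comp : OracleCode → OracleCode → OracleCode
  | prec : OracleCode → OracleCode → OracleCode
  | rfind : OracleCode → OracleCode

/-- `c.eval p` is the partial function `ℕ → ℕ` computed by the program `c` with the infinite
input `p`; the clauses are those of `Nat.RecursiveIn`. -/
def OracleCode.eval (p : Baire) : OracleCode → ℕ →. ℕ
  | .zero => fun _ => Part.some 0
  | .succ => fun n => Part.some (n + 1)
  | .left => fun n => Part.some n.unpair.1
  | .right => fun n => Part.some n.unpair.2
  | .oracle => fun n => Part.some (p n)
  | .pair c d => fun n => Nat.pair <$> c.eval p n <*> d.eval p n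
  | .comp c d => fun n => d.eval p n >>= c.eval p
  | .prec c d => fun m =>
      m.unpair.2.rec (c.eval p m.unpair.1) fun y IH => do
        let i ← IH
        d.eval p (Nat.pair m.unpair.1 (Nat.pair y i))
  | .rfind c => fun a => Nat.rfind fun n => (fun m => decide (m = 0)) <$> c.eval p (Nat.pair a n)

/-- For a fixed infinite input `p`, the programs compute exactly the functions that Mathlib calls
recursive in `p`. -/
theorem OracleCode.exists_eval_iff (p : Baire) (f : ℕ →. ℕ) :
    (∃ c : OracleCode, c.eval p = f) ↔ Nat.RecursiveIn {(p : ℕ →. ℕ)} f := by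
  constructor
  · rintro ⟨c, rfl⟩
    induction c with
    | zero => exact .zero
    | succ => exact .succ
    | left => exact .left
    | right => exact .right
    | oracle => exact .oracle _ rfl
    | pair _ _ h1 h2 => exact .pair h1 h2
    | comp _ _ h1 h2 => exact .comp h1 h2
    | prec _ _ h1 h2 => exact .prec h1 h2
    | rfind _ h => exact .rfind h
  · intro h
    induction h with
    | zero => exact ⟨.zero, rfl⟩
    | succ => exact ⟨.succ, rfl⟩
    | left => exact ⟨.left, rfl⟩
    | right => exact ⟨.right, rfl⟩
    | oracle g hg => obtain rfl := hg; exact ⟨.oracle, rfl⟩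
    | pair _ _ h1 h2 =>
      obtain ⟨c, rfl⟩ := h1; obtain ⟨d, rfl⟩ := h2; exact ⟨.pair c d, rfl⟩
    | comp _ _ h1 h2 =>
      obtain ⟨c, rfl⟩ := h1; obtain ⟨d, rfl⟩ := h2; exact ⟨.comp c d, rfl⟩
    | prec _ _ h1 h2 =>
      obtain ⟨c, rfl⟩ := h1; obtain ⟨d, rfl⟩ := h2; exact ⟨.prec c d, rfl⟩
    | rfind _ h => obtain ⟨c, rfl⟩ := h; exact ⟨.rfind c, rfl⟩

/-- The partial function on Baire space computed by a program: it is defined at `p` when every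
place of the output is produced, and the `n`-th output symbol is then `c.eval p n`. -/
def OracleCode.fn (c : OracleCode) : Baire →. Baire := fun p =>
  ⟨∀ n, (c.eval p n).Dom, fun h n => (c.eval p n).get (h n)⟩

/-- A partial function on Baire space is computable if some machine computes it. -/
def IsComputable (F : Baire →. Baire) : Prop := ∃ c : OracleCode, F = c.fn

/-! ### Representations, problems, strong Weihrauch reducibility -/

/-- A representation of `X`: a surjective partial function from Baire space onto `X`, given by its
graph (`Names p x` says that `p` is a name of `x`). -/
structure Representation (X : Type) where
  Names : Baire → X → Prop
  unique : ∀ {p x y}, Names p x → Names p y → x = y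
  surjective : ∀ x, ∃ p, Names p x

/-- The pairing `⟨p, q⟩` of two points of Baire space is `p 0, q 0, p 1, q 1, …`; a name of
`(x, y)` is the pairing of a name of `x` and a name of `y`. -/
def Representation.prod {X Y : Type} (σ : Representation X) (τ : Representation Y) :
    Representation (X × Y) where
  Names p z := σ.Names (fun n => p (2 * n)) z.1 ∧ τ.Names (fun n => p (2 * n + 1)) z.2
  unique h h' := Prod.ext (σ.unique h.1 h'.1) (τ.unique h.2 h'.2)
  surjective z := by
    obtain ⟨p, hp⟩ := σ.surjective z.1
    obtain ⟨q, hq⟩ := τ.surjective z.2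
    refine ⟨fun n => if n % 2 = 0 then p (n / 2) else q (n / 2), ?_, ?_⟩
    · convert hp using 2 with n
      simp
    · convert hq using 2 with n
      have h1 : (2 * n + 1) % 2 = 1 := by omega
      have h2 : (2 * n + 1) / 2 = n := by omega
      simp [h1, h2]

/-- A partial multi-valued function between represented spaces; its domain is the set of all `x`
with `values x` nonempty. -/
structure Problem where
  Input : Type
  Output : Type
  inRep : Representation Input
  outRep : Representation Output
  values : Input → Set Output

/-- `F` is a realizer of `f`: it maps every name of every point `x` of the domain of `f` to a name
of some element of `f x`. -/
def Realizes (F : Baire →. Baire) (f : Problem) : Prop :=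
  ∀ p x, f.inRep.Names p x → (f.values x).Nonempty →
    ∃ q ∈ F p, ∃ y ∈ f.values x, f.outRep.Names q y

/-- Strong Weihrauch reducibility: there are computable `H`, `K` such that `H ∘ G ∘ K` is a
realizer of `f` whenever `G` is a realizer of `g`. -/
def StrongReducible (f g : Problem) : Prop :=
  ∃ H K : Baire →. Baire, IsComputable H ∧ IsComputable K ∧
    ∀ G : Baire →. Baire, Realizes G g →
      Realizes (fun p => (K p).bind fun q => (G q).bind H) f

/-- Strong Weihrauch equivalence. -/
def StrongEquiv (f g : Problem) : Prop := StrongReducible f g ∧ StrongReducible g f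

/-! ### Computable metric spaces and their hyperspaces of closed sets -/

/-- An effective enumeration of the rational numbers (with repetitions). -/
def ratEnum (k : ℕ) : ℚ :=
  ((k.unpair.1.unpair.1 : ℚ) - (k.unpair.1.unpair.2 : ℚ)) / ((k.unpair.2 : ℚ) + 1)

/-- An effective enumeration of the nonnegative rational numbers (with repetitions). -/
def nnratEnum (m : ℕ) : ℚ := (m.unpair.1 : ℚ) / ((m.unpair.2 : ℚ) + 1)

/-- A computable metric space: a metric space with a dense sequence `pt` such that
`(i, j) ↦ dist (pt i) (pt j)` is a computable double sequence of real numbers. -/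
class ComputableMetricSpace (X : Type) [MetricSpace X] where
  pt : ℕ → X
  dense : DenseRange pt
  dist_computable : ∃ f : ℕ × ℕ × ℕ → ℕ, Computable f ∧
    ∀ i j k, |dist (pt i) (pt j) - (ratEnum (f (i, j, k)) : ℝ)| ≤ 2⁻¹ ^ k

section Spaces

variable (X : Type) [MetricSpace X] [ComputableMetricSpace X]

/-- The Cauchy representation. -/
def cauchyRep : Representation X where
  Names p x :=
    (∀ i j, i ≤ j → dist (ComputableMetricSpace.pt (X := X) (p i))
      (ComputableMetricSpace.pt (p j)) ≤ 2⁻¹ ^ i) ∧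
    Filter.Tendsto (fun i => ComputableMetricSpace.pt (X := X) (p i)) Filter.atTop (𝓝 x)
  unique h h' := tendsto_nhds_unique h.2 h'.2
  surjective x := by
    have h : ∀ i : ℕ, ∃ k, dist x (ComputableMetricSpace.pt (X := X) k) < 2⁻¹ ^ (i + 1) :=
      fun i => ComputableMetricSpace.dense.exists_dist_lt x (by positivity)
    choose p hp using h
    refine ⟨p, fun i j hij => ?_, ?_⟩
    · have h1 := dist_triangle_left (ComputableMetricSpace.pt (X := X) (p i))
        (ComputableMetricSpace.pt (p j)) x
      have h2 : (2⁻¹ : ℝ) ^ (j + 1) ≤ 2⁻¹ ^ (i + 1) :=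
        pow_le_pow_of_le_one (by norm_num) (by norm_num) (by omega)
      have h3 : (2⁻¹ : ℝ) ^ (i + 1) + 2⁻¹ ^ (i + 1) = 2⁻¹ ^ i := by ring
      linarith [hp i, hp j]
    · rw [tendsto_iff_dist_tendsto_zero]
      have h0 : Filter.Tendsto (fun i : ℕ => (2⁻¹ : ℝ) ^ (i + 1)) Filter.atTop (𝓝 0) :=
        (tendsto_pow_atTop_nhds_zero_of_lt_one (by norm_num) (by norm_num)).comp
          (Filter.tendsto_add_atTop_nat 1)
      refine squeeze_zero (fun _ => dist_nonneg) (fun i => ?_) h0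
      rw [dist_comm]
      exact (hp i).le

variable {X} in
/-- The basic open ball with index `k = ⟨n, m⟩`: centre `pt n` and radius `nnratEnum m`. It is
empty when the radius is zero. -/
def basicBall (k : ℕ) : Set X :=
  Metric.ball (ComputableMetricSpace.pt k.unpair.1) (nnratEnum k.unpair.2 : ℝ)

/-- The negative information representation of the closed subsets of `X`: a name of `A` lists
basic open balls whose union is the complement of `A`. -/
def negRep : Representation (TopologicalSpace.Closeds X) where
  Names p A := (A : Set X) = (⋃ i : ℕ, basicBall (p i))ᶜ
  unique h h' := SetLike.coe_injective (h.trans h'.symm)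
  surjective A := by
    classical
    refine ⟨fun k => if basicBall k ⊆ (A : Set X)ᶜ then k else 0, ?_⟩
    have h0 : (basicBall 0 : Set X) = ∅ := by
      simp [basicBall, nnratEnum]
    ext x
    simp only [Set.mem_compl_iff, Set.mem_iUnion, not_exists]
    constructor
    · intro hx k
      split_ifs with h
      · exact fun hk => h hk hx
      · simp [h0]
    · intro hx
      by_contra hA
      obtain ⟨r, hr, hball⟩ := Metric.isOpen_iff.1 A.isClosed.isOpen_compl x hA
      obtain ⟨b, hb⟩ := exists_nat_gt (2 / r)
      have hb1 : (0 : ℝ) < (b : ℝ) + 1 := by positivity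
      have hs : 2 * (1 / ((b : ℝ) + 1)) < r := by
        rw [div_lt_iff₀ hr] at hb
        rw [mul_one_div, div_lt_iff₀ hb1]
        nlinarith
      obtain ⟨n, hn⟩ := (ComputableMetricSpace.dense (X := X)).exists_dist_lt x
        (show (0 : ℝ) < 1 / ((b : ℝ) + 1) by positivity)
      have hset : (basicBall (Nat.pair n (Nat.pair 1 b)) : Set X) =
          Metric.ball (ComputableMetricSpace.pt n) (1 / ((b : ℝ) + 1)) := by
        simp [basicBall, nnratEnum]
      have hsub : (basicBall (Nat.pair n (Nat.pair 1 b)) : Set X) ⊆ (A : Set X)ᶜ := by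
        rw [hset]
        intro y hy
        apply hball
        rw [Metric.mem_ball] at hy ⊢
        have := dist_triangle_right y x (ComputableMetricSpace.pt (X := X) n)
        linarith
      have := hx (Nat.pair n (Nat.pair 1 b))
      rw [if_pos hsub, hset, Metric.mem_ball] at this
      exact this hn

/-! ### The two problems -/

/-- Closed choice on `X`: given a nonempty closed set by negative information, find a point of
it. -/
def closedChoice : Problem where
  Input := TopologicalSpace.Closeds X
  Output := X
  inRep := negRep X
  outRep := cauchyRep X
  values A := (A : Set X)

/-- The `ε`-approximate negative closed projection operator on `X`: given a point `x` and a
nonempty closed set `A`, the latter by negative information, find an `ε`-projection point of `x`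
onto `A`, that is `y ∈ A` with `d(x, y) ≤ (1 + ε) d(x, A)`. -/
noncomputable def approxNegProj (ε : ℝ) : Problem where
  Input := X × TopologicalSpace.Closeds X
  Output := X
  inRep := (cauchyRep X).prod (negRep X)
  outRep := cauchyRep X
  values z := {y | y ∈ z.2 ∧ dist z.1 y ≤ (1 + ε) * Metric.infDist z.1 (z.2 : Set X)}

end Spaces

/-! ### The Euclidean spaces as computable metric spaces -/

/-- The `k`-th rational point of `ℝ^n`: decode `k` as a finite list of natural numbers and apply
the enumeration of the rational numbers to its first `n` entries (absent entries count as `0`). -/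
noncomputable def ratPoint (n k : ℕ) : EuclideanSpace ℝ (Fin n) :=
  WithLp.toLp 2 fun i => (ratEnum ((Denumerable.ofNat (List ℕ) k).getD i 0) : ℝ)


theorem ratEnum_surjective : Function.Surjective ratEnum := by
  intro q
  refine ⟨Nat.pair (Nat.pair q.num.toNat (-q.num).toNat) (q.den - 1), ?_⟩
  have h1 : ((q.den - 1 : ℕ) : ℚ) + 1 = q.den := by
    have := q.den_pos
    exact_mod_cast Nat.sub_add_cancel this
  have h2 : ((q.num.toNat : ℚ) - ((-q.num).toNat : ℚ)) = q.num := by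
    exact_mod_cast (show ((q.num.toNat : ℤ) - ((-q.num).toNat : ℤ)) = q.num by omega)
  simp only [ratEnum, Nat.unpair_pair]
  rw [h1, h2, Rat.num_div_den]

/-- Numerator of the square of the difference of two enumerated rational numbers. -/
def sqNum (x y : ℕ) : ℕ :=
  let u := x.unpair.1.unpair.1 * (y.unpair.2 + 1) + y.unpair.1.unpair.2 * (x.unpair.2 + 1)
  let v := x.unpair.1.unpair.2 * (y.unpair.2 + 1) + y.unpair.1.unpair.1 * (x.unpair.2 + 1)
  ((u - v) + (v - u)) * ((u - v) + (v - u))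

/-- Denominator of the square of the difference of two enumerated rational numbers. -/
def sqDen (x y : ℕ) : ℕ :=
  ((x.unpair.2 + 1) * (y.unpair.2 + 1)) * ((x.unpair.2 + 1) * (y.unpair.2 + 1))

theorem sqDen_pos (x y : ℕ) : 0 < sqDen x y := by unfold sqDen; positivity

theorem sq_ratEnum_sub (x y : ℕ) :
    ((ratEnum x : ℝ) - (ratEnum y : ℝ)) ^ 2 = (sqNum x y : ℝ) / (sqDen x y : ℝ) := by
  have key : ∀ u v : ℕ, ((((u - v) + (v - u)) * ((u - v) + (v - u)) : ℕ) : ℝ)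
      = ((u : ℝ) - v) ^ 2 := by
    intro u v
    rcases le_total u v with h | h
    · rw [Nat.sub_eq_zero_of_le h]; push_cast [Nat.cast_sub h]; ring
    · rw [Nat.sub_eq_zero_of_le h]; push_cast [Nat.cast_sub h]; ring
  simp only [sqNum, key, sqDen, ratEnum]
  push_cast
  field_simp
  ring

theorem sqNum_primrec : Primrec₂ sqNum := by
  have hx : Primrec fun z : ℕ × ℕ => z.1.unpair := Primrec.unpair.comp Primrec.fst
  have hy : Primrec fun z : ℕ × ℕ => z.2.unpair := Primrec.unpair.comp Primrec.snd
  have hx1 : Primrec fun z : ℕ × ℕ => z.1.unpair.1.unpair :=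
    Primrec.unpair.comp (Primrec.fst.comp hx)
  have hy1 : Primrec fun z : ℕ × ℕ => z.2.unpair.1.unpair :=
    Primrec.unpair.comp (Primrec.fst.comp hy)
  have hxd : Primrec fun z : ℕ × ℕ => z.1.unpair.2 + 1 := Primrec.succ.comp (Primrec.snd.comp hx)
  have hyd : Primrec fun z : ℕ × ℕ => z.2.unpair.2 + 1 := Primrec.succ.comp (Primrec.snd.comp hy)
  have hu := Primrec.nat_add.comp (Primrec.nat_mul.comp (Primrec.fst.comp hx1) hyd)
    (Primrec.nat_mul.comp (Primrec.snd.comp hy1) hxd)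
  have hv := Primrec.nat_add.comp (Primrec.nat_mul.comp (Primrec.snd.comp hx1) hyd)
    (Primrec.nat_mul.comp (Primrec.fst.comp hy1) hxd)
  have hs := Primrec.nat_add.comp (Primrec.nat_sub.comp hu hv) (Primrec.nat_sub.comp hv hu)
  exact (Primrec.nat_mul.comp hs hs).of_eq fun z => rfl

theorem sqDen_primrec : Primrec₂ sqDen := by
  have hxd : Primrec fun z : ℕ × ℕ => z.1.unpair.2 + 1 :=
    Primrec.succ.comp (Primrec.snd.comp (Primrec.unpair.comp Primrec.fst))
  have hyd : Primrec fun z : ℕ × ℕ => z.2.unpair.2 + 1 :=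
    Primrec.succ.comp (Primrec.snd.comp (Primrec.unpair.comp Primrec.snd))
  have hm := Primrec.nat_mul.comp hxd hyd
  exact (Primrec.nat_mul.comp hm hm).of_eq fun z => rfl

/-- Index of a rational number within `2^(-k)` of the square root of `N / M`. -/
def sqrtIndex (N M k : ℕ) : ℕ :=
  Nat.pair (Nat.pair (Nat.sqrt (N * M * (2 ^ k * 2 ^ k))) 0) (2 ^ k * M - 1)

theorem sqrtIndex_spec (N M k : ℕ) (hM : 0 < M) :
    |Real.sqrt ((N : ℝ) / M) - (ratEnum (sqrtIndex N M k) : ℝ)| ≤ 2⁻¹ ^ k := by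
  have hM' : (0 : ℝ) < M := by exact_mod_cast hM
  have hP : 0 < 2 ^ k * M := by positivity
  have hden : ((2 ^ k * M - 1 : ℕ) : ℝ) + 1 = 2 ^ k * M := by
    exact_mod_cast Nat.sub_add_cancel hP
  set t := Nat.sqrt (N * M * (2 ^ k * 2 ^ k)) with ht
  have hr : (ratEnum (sqrtIndex N M k) : ℝ) = t / (2 ^ k * M) := by
    simp only [ratEnum, sqrtIndex, Nat.unpair_pair, ← ht]
    push_cast
    rw [hden]; simp
  have hpos : (0 : ℝ) < 2 ^ k * M := by positivity
  have hs : Real.sqrt ((N : ℝ) / M) = Real.sqrt (N * M * (2 ^ k * 2 ^ k)) / (2 ^ k * M) := by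
    rw [eq_div_iff hpos.ne']
    rw [← Real.sqrt_sq hpos.le, ← Real.sqrt_mul (by positivity)]
    congr 1
    field_simp
  have h1 : (t : ℝ) ≤ Real.sqrt (N * M * (2 ^ k * 2 ^ k)) := by
    apply Real.le_sqrt_of_sq_le
    exact_mod_cast Nat.sqrt_le' _
  have h2 : Real.sqrt (N * M * (2 ^ k * 2 ^ k)) ≤ t + 1 := by
    rw [Real.sqrt_le_left (by positivity)]
    exact_mod_cast (Nat.lt_succ_sqrt' _).le
  rw [hr, hs, ← sub_div, abs_of_nonneg (div_nonneg (by linarith) hpos.le), div_le_iff₀ hpos]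
  have h3 : (2⁻¹ : ℝ) ^ k * (2 ^ k * M) = M := by
    rw [← mul_assoc, ← mul_pow]; norm_num
  have h4 : (1 : ℝ) ≤ M := by exact_mod_cast hM
  rw [h3]; linarith

theorem sqrtIndex_computable {N M k : ℕ × ℕ × ℕ → ℕ} (hN : Computable N) (hM : Computable M)
    (hk : Computable k) : Computable fun z => sqrtIndex (N z) (M z) (k z) := by
  have hpow : Primrec fun n : ℕ => 2 ^ n :=
    (Primrec.nat_rec₁ (f := fun _ r => 2 * r) 1
      (Primrec.nat_mul.comp (Primrec.const 2) Primrec.snd)).of_eq fun n => by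
        induction n with
        | zero => rfl
        | succ n ih => rw [pow_succ, ← ih, mul_comm]
  have hp : Computable fun z => 2 ^ k z := hpow.to_comp.comp hk
  have mul := Primrec.nat_mul.to_comp
  have h1 := mul.comp (mul.comp hN hM) (mul.comp hp hp)
  have h2 := Primrec.nat_sqrt.to_comp.comp h1
  have h3 := Primrec.nat_sub.to_comp.comp (mul.comp hp hM) (Computable.const 1)
  exact (Primrec₂.natPair.to_comp.comp (Primrec₂.natPair.to_comp.comp h2 (Computable.const 0))
    h3).of_eq fun z => rfl

/-- The real line with the enumeration of the rational numbers. -/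
noncomputable instance instRealComputableMetricSpace : ComputableMetricSpace ℝ where
  pt k := (ratEnum k : ℝ)
  dense := Rat.isDenseEmbedding_coe_real.dense.comp ratEnum_surjective.denseRange
    Rat.continuous_coe_real
  dist_computable := by
    refine ⟨fun z => sqrtIndex (sqNum z.1 z.2.1) (sqDen z.1 z.2.1) z.2.2, ?_, fun i j k => ?_⟩
    · have h1 : Computable fun z : ℕ × ℕ × ℕ => z.1 := Computable.fst
      have h2 : Computable fun z : ℕ × ℕ × ℕ => z.2.1 := Computable.fst.comp Computable.snd
      exact sqrtIndex_computable (sqNum_primrec.to_comp.comp h1 h2)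
        (sqDen_primrec.to_comp.comp h1 h2) (Computable.snd.comp Computable.snd)
    · have := sqrtIndex_spec (sqNum i j) (sqDen i j) k (sqDen_pos i j)
      rwa [← sq_ratEnum_sub, Real.sqrt_sq_eq_abs, ← Real.dist_eq] at this

/-- Numerator and denominator of the squared distance of two rational points of `ℝ^n`. -/
def sqDist (i j : ℕ) : ℕ → ℕ × ℕ
  | 0 => (0, 1)
  | n + 1 =>
    let x := (Denumerable.ofNat (List ℕ) i).getD n 0
    let y := (Denumerable.ofNat (List ℕ) j).getD n 0
    ((sqDist i j n).1 * sqDen x y + sqNum x y * (sqDist i j n).2, (sqDist i j n).2 * sqDen x y)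

theorem sqDist_pos (i j n : ℕ) : 0 < (sqDist i j n).2 := by
  induction n with
  | zero => exact Nat.one_pos
  | succ n ih => exact Nat.mul_pos ih (sqDen_pos _ _)

theorem sqDist_spec (i j n : ℕ) :
    dist (ratPoint n i) (ratPoint n j) =
      Real.sqrt (((sqDist i j n).1 : ℝ) / ((sqDist i j n).2 : ℝ)) := by
  rw [EuclideanSpace.dist_eq]
  congr 1
  induction n with
  | zero => simp [sqDist]
  | succ n ih =>
    rw [Fin.sum_univ_castSucc]
    have h1 := sqDist_pos i j n
    simp only [ratPoint, Fin.val_castSucc, Fin.val_last, Real.dist_eq, sq_abs] at ih ⊢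
    rw [ih, sq_ratEnum_sub]
    simp only [sqDist]
    have h2 := sqDen_pos ((Denumerable.ofNat (List ℕ) i).getD n 0)
      ((Denumerable.ofNat (List ℕ) j).getD n 0)
    push_cast
    rw [div_add_div _ _ (by positivity) (by positivity)]
    ring

theorem sqDist_primrec (n : ℕ) : Primrec₂ fun i j => sqDist i j n := by
  induction n with
  | zero => exact Primrec.const (0, 1)
  | succ n ih =>
    have hx : Primrec fun z : ℕ × ℕ => (Denumerable.ofNat (List ℕ) z.1).getD n 0 :=
      (Primrec.list_getD 0).comp ((Primrec.ofNat (List ℕ)).comp Primrec.fst) (Primrec.const n)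
    have hy : Primrec fun z : ℕ × ℕ => (Denumerable.ofNat (List ℕ) z.2).getD n 0 :=
      (Primrec.list_getD 0).comp ((Primrec.ofNat (List ℕ)).comp Primrec.snd) (Primrec.const n)
    have hd := sqDen_primrec.comp hx hy
    have hn := sqNum_primrec.comp hx hy
    have ih' : Primrec fun z : ℕ × ℕ => sqDist z.1 z.2 n := ih
    have h1 := Primrec.fst.comp ih'
    have h2 := Primrec.snd.comp ih'
    exact (Primrec.pair (Primrec.nat_add.comp (Primrec.nat_mul.comp h1 hd)
      (Primrec.nat_mul.comp hn h2)) (Primrec.nat_mul.comp h2 hd)).of_eq fun z => rfl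

theorem ratPoint_dense (n : ℕ) : DenseRange (ratPoint n) := by
  have h : DenseRange fun q : Fin n → ℚ =>
      (WithLp.toLp 2 fun i => (q i : ℝ) : EuclideanSpace ℝ (Fin n)) := by
    have h1 : DenseRange fun (q : Fin n → ℚ) (i : Fin n) => (q i : ℝ) :=
      DenseRange.piMap fun _ => Rat.isDenseEmbedding_coe_real.dense
    exact (EuclideanSpace.equiv (Fin n) ℝ).symm.surjective.denseRange.comp h1
      (EuclideanSpace.equiv (Fin n) ℝ).symm.continuous
  refine h.mono ?_
  rintro _ ⟨q, rfl⟩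
  choose g hg using ratEnum_surjective
  refine ⟨Encodable.encode (List.ofFn fun i => g (q i)), ?_⟩
  simp only [ratPoint, Denumerable.ofNat_encode]
  congr 1
  funext i
  simp [List.getD, hg]

/-- Euclidean space `ℝ^n` with the enumeration of its rational points. -/
noncomputable instance instEuclideanComputableMetricSpace (n : ℕ) :
    ComputableMetricSpace (EuclideanSpace ℝ (Fin n)) where
  pt := ratPoint n
  dense := ratPoint_dense n
  dist_computable := by
    refine ⟨fun z => sqrtIndex (sqDist z.1 z.2.1 n).1 (sqDist z.1 z.2.1 n).2 z.2.2, ?_,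
      fun i j k => ?_⟩
    · have h : Computable fun z : ℕ × ℕ × ℕ => sqDist z.1 z.2.1 n :=
        (sqDist_primrec n).to_comp.comp Computable.fst (Computable.fst.comp Computable.snd)
      exact sqrtIndex_computable (Computable.fst.comp h) (Computable.snd.comp h)
        (Computable.snd.comp Computable.snd)
    · rw [sqDist_spec]
      exact sqrtIndex_spec _ _ k (sqDist_pos i j n)

end Weih

/-!
Closed choice on `ℝ` is found from approximate projections by projecting the origin to the closed
set of all points whose first coordinate lies in the given set.

For the converse fix a rational `c` with `1 < c ≤ 1 + ε` and let `x` and `A` be given by names. That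
`d(x, A) ≥ q` has a finite certificate: finitely many small cubes cover the closed ball of radius
`q` around `x`, and by compactness each of them is eventually seen to be disjoint from `A` or from
the ball. So there is a forest with computable complement whose roots propose such a certificate
and whose infinite branches below a valid root are the nested sequences of cubes which are never
refuted to contain some `y ∈ A` with `d(x, y) ≤ c q`, hence lead to `ε`-approximate projection
points. Taking `q` slightly below `d(x, A)`, or `q = 0` if `x ∈ A`, shows that there is at least one
branch.

The branches are then encoded as a closed set of real numbers via digit expansions to a base `B`.
Requiring the fractional part of `B ^ k * x` to be at most `1/2` leaves gaps around the points where
the digits jump, and so the digits are computable from `x`, which is not the case for arbitrary real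
numbers.
-/

namespace Weih

open Encodable

/-! ### Functions computed uniformly in an infinite input -/

section EvalLemmas

variable {c d : OracleCode} {p : Baire}

theorem OracleCode.eval_comp_of_eq {n m : ℕ} (h : d.eval p n = Part.some m) :
    (comp c d).eval p n = c.eval p m := by
  simp only [eval, h]
  exact Part.bind_some _ _

theorem OracleCode.eval_pair_of_eq {n a b : ℕ} (hc : c.eval p n = Part.some a)
    (hd : d.eval p n = Part.some b) : (pair c d).eval p n = Part.some (Nat.pair a b) := by
  simp [eval, hc, hd, Seq.seq]

theorem OracleCode.eval_prec_of_eq {a : ℕ} {f : ℕ → ℕ} (h0 : c.eval p a = Part.some (f 0))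
    (hs : ∀ k, d.eval p (Nat.pair a (Nat.pair k (f k))) = Part.some (f (k + 1))) (k : ℕ) :
    (prec c d).eval p (Nat.pair a k) = Part.some (f k) := by
  simp only [eval, Nat.unpair_pair]
  induction k with
  | zero => exact h0
  | succ k ih =>
    rw [← hs k]
    dsimp only
    rw [ih]
    exact Part.bind_some _ _

end EvalLemmas

theorem OracleCode.exists_eval_eq_of_primrec {f : ℕ → ℕ} (hf : Nat.Primrec f) :
    ∃ c : OracleCode, ∀ p n, c.eval p n = Part.some (f n) := by
  induction hf with
  | zero => exact ⟨zero, fun _ _ => rfl⟩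
  | succ => exact ⟨succ, fun _ _ => rfl⟩
  | left => exact ⟨left, fun _ _ => rfl⟩
  | right => exact ⟨right, fun _ _ => rfl⟩
  | pair _ _ ihf ihg =>
    obtain ⟨c, hc⟩ := ihf
    obtain ⟨d, hd⟩ := ihg
    exact ⟨pair c d, fun p n => eval_pair_of_eq (hc p n) (hd p n)⟩
  | comp _ _ ihf ihg =>
    obtain ⟨c, hc⟩ := ihf
    obtain ⟨d, hd⟩ := ihg
    exact ⟨comp c d, fun p n => (eval_comp_of_eq (hd p n)).trans (hc p _)⟩
  | prec _ _ ihf ihg =>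
    obtain ⟨c, hc⟩ := ihf
    obtain ⟨d, hd⟩ := ihg
    refine ⟨prec c d, fun p n => ?_⟩
    rw [← Nat.pair_unpair n, eval_prec_of_eq (f := fun k => Nat.unpaired _ (Nat.pair n.unpair.1 k))]
    · simp [hc]
    · simp [hd]

theorem OracleCode.exists_eval_substitute {d : OracleCode} {D : Baire → Baire}
    (hd : ∀ p n, d.eval p n = Part.some (D p n)) (c : OracleCode) :
    ∃ c' : OracleCode, ∀ p, c'.eval p = c.eval (D p) := by
  induction c with
  | zero => exact ⟨zero, fun _ => rfl⟩
  | succ => exact ⟨succ, fun _ => rfl⟩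
  | left => exact ⟨left, fun _ => rfl⟩
  | right => exact ⟨right, fun _ => rfl⟩
  | oracle => exact ⟨d, fun p => funext (hd p)⟩
  | pair _ _ ihc ihd =>
    obtain ⟨c', hc'⟩ := ihc
    obtain ⟨d', hd'⟩ := ihd
    exact ⟨pair c' d', fun p => funext fun _ => by simp only [eval, hc', hd']⟩
  | comp _ _ ihc ihd =>
    obtain ⟨c', hc'⟩ := ihc
    obtain ⟨d', hd'⟩ := ihd
    exact ⟨comp c' d', fun p => funext fun _ => by simp only [eval, hc', hd']⟩
  | prec _ _ ihc ihd =>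
    obtain ⟨c', hc'⟩ := ihc
    obtain ⟨d', hd'⟩ := ihd
    exact ⟨prec c' d', fun p => funext fun _ => by simp only [eval, hc', hd']⟩
  | rfind _ ih =>
    obtain ⟨c', hc'⟩ := ih
    exact ⟨rfind c', fun p => funext fun _ => by simp only [eval, hc']⟩

/-- A total function `F : Baire → α → σ` is uniformly computable if a single oracle machine
computes `F p : α → σ` from the infinite input `p`. -/
def UniformlyComputable {α σ : Type} [Encodable α] [Encodable σ] (F : Baire → α → σ) : Prop :=
  ∃ c : OracleCode, ∀ p a, c.eval p (encode a) = Part.some (encode (F p a))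

namespace UniformlyComputable

variable {α β σ τ : Type} [Primcodable α] [Primcodable β] [Primcodable σ] [Primcodable τ]

theorem of_primrec {f : α → σ} (hf : Primrec f) : UniformlyComputable fun _ => f := by
  -- `Primrec f` is about `encode (some (f a)) = encode (f a) + 1`, hence the predecessor.
  obtain ⟨c, hc⟩ := OracleCode.exists_eval_eq_of_primrec (Nat.Primrec.pred.comp hf)
  exact ⟨c, fun p a => by simp [hc]⟩

protected theorem id : UniformlyComputable fun _ (a : α) => a := of_primrec .id

protected theorem const (s : σ) : UniformlyComputable fun _ (_ : α) => s := of_primrec (.const s)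

theorem fst : UniformlyComputable fun _ (z : α × β) => z.1 := of_primrec .fst

theorem snd : UniformlyComputable fun _ (z : α × β) => z.2 := of_primrec .snd

theorem comp {F : Baire → β → σ} {G : Baire → α → β} (hF : UniformlyComputable F)
    (hG : UniformlyComputable G) : UniformlyComputable fun p a => F p (G p a) := by
  obtain ⟨c, hc⟩ := hF
  obtain ⟨d, hd⟩ := hG
  exact ⟨.comp c d, fun p a => (OracleCode.eval_comp_of_eq (hd p a)).trans (hc p _)⟩

theorem pair {F : Baire → α → σ} {G : Baire → α → τ} (hF : UniformlyComputable F)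
    (hG : UniformlyComputable G) : UniformlyComputable fun p a => (F p a, G p a) := by
  obtain ⟨c, hc⟩ := hF
  obtain ⟨d, hd⟩ := hG
  exact ⟨.pair c d, fun p a => OracleCode.eval_pair_of_eq (hc p a) (hd p a)⟩

theorem map {f : β → σ} {G : Baire → α → β} (hf : Primrec f) (hG : UniformlyComputable G) :
    UniformlyComputable fun p a => f (G p a) :=
  (of_primrec hf).comp hG

theorem map₂ {f : β → σ → τ} {F : Baire → α → β} {G : Baire → α → σ} (hf : Primrec₂ f)
    (hF : UniformlyComputable F) (hG : UniformlyComputable G) :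
    UniformlyComputable fun p a => f (F p a) (G p a) :=
  (of_primrec hf).comp (hF.pair hG)

theorem oracle {F : Baire → α → ℕ} (hF : UniformlyComputable F) :
    UniformlyComputable fun p a => p (F p a) := by
  obtain ⟨c, hc⟩ := hF
  exact ⟨.comp .oracle c, fun p a => OracleCode.eval_comp_of_eq (hc p a)⟩

protected theorem cond {b : Baire → α → Bool} {F G : Baire → α → σ} (hb : UniformlyComputable b)
    (hF : UniformlyComputable F) (hG : UniformlyComputable G) :
    UniformlyComputable fun p a => bif b p a then F p a else G p a :=
  .map (f := fun z : Bool × σ × σ => cond z.1 z.2.1 z.2.2)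
    (Primrec.cond .fst (Primrec.fst.comp .snd) (Primrec.snd.comp .snd)) (hb.pair (hF.pair hG))

theorem natRec {F : Baire → α → σ} {G : Baire → α × ℕ × σ → σ} {N : Baire → α → ℕ}
    (hF : UniformlyComputable F) (hG : UniformlyComputable G) (hN : UniformlyComputable N) :
    UniformlyComputable fun p a =>
      Nat.rec (motive := fun _ => σ) (F p a) (fun k s => G p (a, k, s)) (N p a) := by
  obtain ⟨c, hc⟩ := hF
  obtain ⟨d, hd⟩ := hG
  obtain ⟨e, he⟩ := UniformlyComputable.id.pair hN
  refine ⟨.comp (.prec c d) e, fun p a => ?_⟩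
  rw [OracleCode.eval_comp_of_eq (he p a)]
  exact OracleCode.eval_prec_of_eq
    (f := fun k => encode (Nat.rec (motive := fun _ => σ) (F p a) (fun k s => G p (a, k, s)) k))
    (hc p a) (fun k => hd p (a, k, _)) (N p a)

theorem substitute {F : Baire → α → σ} {D : Baire → Baire} (hF : UniformlyComputable F)
    (hD : UniformlyComputable D) : UniformlyComputable fun p => F (D p) := by
  obtain ⟨c, hc⟩ := hF
  obtain ⟨d, hd⟩ := hD
  obtain ⟨c', hc'⟩ := OracleCode.exists_eval_substitute hd c
  exact ⟨c', fun p a => (congrFun (hc' p) _).trans (hc _ a)⟩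

theorem isComputable {F : Baire → Baire} (hF : UniformlyComputable F) :
    IsComputable fun p => Part.some (F p) := by
  obtain ⟨c, hc⟩ := hF
  simp only [encode_nat] at hc
  refine ⟨c, funext fun p => Part.ext' ?_ fun _ _ => ?_⟩
  · simp [OracleCode.fn, hc]
  · simp [OracleCode.fn, hc]

end UniformlyComputable

open Classical in
/-- A predicate `Q : Baire → α → Prop` is uniformly decidable if a single oracle machine decides
`Q p a` from the infinite input `p` and `a`. -/
def UniformlyDecidable {α : Type} [Encodable α] (Q : Baire → α → Prop) : Prop :=
  UniformlyComputable fun p a => decide (Q p a)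

namespace UniformlyDecidable

variable {α β σ : Type} [Primcodable α] [Primcodable β] [Primcodable σ] {P Q : Baire → α → Prop}

theorem of_primrecPred {R : α → Prop} (hR : PrimrecPred R) : UniformlyDecidable fun _ => R :=
  UniformlyComputable.of_primrec (by classical exact hR.decide)

theorem comp {R : Baire → β → Prop} {G : Baire → α → β} (hR : UniformlyDecidable R)
    (hG : UniformlyComputable G) : UniformlyDecidable fun p a => R p (G p a) :=
  UniformlyComputable.comp hR hG

protected theorem not (hP : UniformlyDecidable P) : UniformlyDecidable fun p a => ¬P p a := by
  classical
  simpa only [UniformlyDecidable, decide_not] using UniformlyComputable.map Primrec.not hP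

protected theorem and (hP : UniformlyDecidable P) (hQ : UniformlyDecidable Q) :
    UniformlyDecidable fun p a => P p a ∧ Q p a := by
  classical
  simpa only [UniformlyDecidable, Bool.decide_and] using UniformlyComputable.map₂ Primrec.and hP hQ

protected theorem or (hP : UniformlyDecidable P) (hQ : UniformlyDecidable Q) :
    UniformlyDecidable fun p a => P p a ∨ Q p a := by
  classical
  simpa only [UniformlyDecidable, Bool.decide_or] using UniformlyComputable.map₂ Primrec.or hP hQ

protected theorem imp (hP : UniformlyDecidable P) (hQ : UniformlyDecidable Q) :
    UniformlyDecidable fun p a => P p a → Q p a := by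
  simpa only [imp_iff_not_or] using hP.not.or hQ

open Classical in
theorem ite {F G : Baire → α → σ} (hP : UniformlyDecidable P) (hF : UniformlyComputable F)
    (hG : UniformlyComputable G) :
    UniformlyComputable fun p a => if P p a then F p a else G p a := by
  simpa only [Bool.cond_decide] using UniformlyComputable.cond hP hF hG

theorem lt {F G : Baire → α → ℕ} (hF : UniformlyComputable F) (hG : UniformlyComputable G) :
    UniformlyDecidable fun p a => F p a < G p a :=
  (of_primrecPred (R := fun z : ℕ × ℕ => z.1 < z.2) Primrec.nat_lt).comp (hF.pair hG)

theorem exists_lt {R : Baire → α × ℕ → Prop} {N : Baire → α → ℕ} (hR : UniformlyDecidable R)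
    (hN : UniformlyComputable N) : UniformlyDecidable fun p a => ∃ i < N p a, R p (a, i) := by
  classical
  have hstep : UniformlyComputable fun p (z : α × ℕ × Bool) => z.2.2 || decide (R p (z.1, z.2.1)) :=
    .map₂ Primrec.or (.of_primrec (Primrec.snd.comp .snd))
      (UniformlyComputable.comp hR
        (.of_primrec (Primrec.pair .fst (Primrec.fst.comp .snd))))
  have hfold (p : Baire) (a : α) (m : ℕ) :
      Nat.rec (motive := fun _ => Bool) false (fun i s => s || decide (R p (a, i))) m = true ↔
        ∃ i < m, R p (a, i) := by
    induction m with
    | zero => simp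
    | succ m ih => simp only [Nat.exists_lt_succ_right, ← ih, Bool.or_eq_true, decide_eq_true_eq]
  simpa only [UniformlyDecidable, ← hfold, Bool.decide_eq_true] using
    UniformlyComputable.natRec (.const false) hstep hN

theorem forall_lt {R : Baire → α × ℕ → Prop} {N : Baire → α → ℕ} (hR : UniformlyDecidable R)
    (hN : UniformlyComputable N) : UniformlyDecidable fun p a => ∀ i < N p a, R p (a, i) := by
  simpa only [not_exists, not_and, not_not] using (hR.not.exists_lt hN).not

end UniformlyDecidable

/-! ### Exact rational arithmetic -/

namespace UniformlyComputable

variable {α : Type} [Primcodable α] {F G : Baire → α → ℕ}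

theorem add (hF : UniformlyComputable F) (hG : UniformlyComputable G) :
    UniformlyComputable fun p a => F p a + G p a :=
  .map₂ Primrec.nat_add hF hG

theorem sub (hF : UniformlyComputable F) (hG : UniformlyComputable G) :
    UniformlyComputable fun p a => F p a - G p a :=
  .map₂ Primrec.nat_sub hF hG

theorem mul (hF : UniformlyComputable F) (hG : UniformlyComputable G) :
    UniformlyComputable fun p a => F p a * G p a :=
  .map₂ Primrec.nat_mul hF hG

theorem div (hF : UniformlyComputable F) (hG : UniformlyComputable G) :
    UniformlyComputable fun p a => F p a / G p a :=
  .map₂ Primrec.nat_div hF hG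

theorem mod (hF : UniformlyComputable F) (hG : UniformlyComputable G) :
    UniformlyComputable fun p a => F p a % G p a :=
  .map₂ Primrec.nat_mod hF hG

theorem natPair (hF : UniformlyComputable F) (hG : UniformlyComputable G) :
    UniformlyComputable fun p a => Nat.pair (F p a) (G p a) :=
  .map₂ Primrec₂.natPair hF hG

theorem unpair_fst (hF : UniformlyComputable F) : UniformlyComputable fun p a => (F p a).unpair.1 :=
  .map (f := fun k : ℕ => k.unpair.1) (Primrec.fst.comp Primrec.unpair) hF

theorem unpair_snd (hF : UniformlyComputable F) : UniformlyComputable fun p a => (F p a).unpair.2 :=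
  .map (f := fun k : ℕ => k.unpair.2) (Primrec.snd.comp Primrec.unpair) hF

theorem pow (hF : UniformlyComputable F) (hG : UniformlyComputable G) :
    UniformlyComputable fun p a => F p a ^ G p a := by
  have hpow (b m : ℕ) : b ^ m = Nat.rec (motive := fun _ => ℕ) 1 (fun _ s => s * b) m := by
    induction m with
    | zero => rfl
    | succ m ih => rw [pow_succ, ih]
  simpa only [hpow] using natRec (.const 1) ((snd.comp snd).mul (hF.comp fst)) hG

end UniformlyComputable

/-- A rational-valued function `r : Baire → α → ℚ` is uniformly computable if natural numbers
`u, v, w` with `r p a = (u - v) / (w + 1)` are computable uniformly in `p`. -/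
def UniformlyComputableRat {α : Type} [Primcodable α] (r : Baire → α → ℚ) : Prop :=
  ∃ u v w : Baire → α → ℕ,
    UniformlyComputable u ∧ UniformlyComputable v ∧ UniformlyComputable w ∧
      ∀ p a, r p a = ((u p a : ℚ) - v p a) / (w p a + 1)

namespace UniformlyComputableRat

variable {α β : Type} [Primcodable α] [Primcodable β] {r s : Baire → α → ℚ} {F : Baire → α → ℕ}

theorem ratEnum (hF : UniformlyComputable F) :
    UniformlyComputableRat fun p a => ratEnum (F p a) :=
  ⟨_, _, _, hF.unpair_fst.unpair_fst, hF.unpair_fst.unpair_snd, hF.unpair_snd, fun _ _ => rfl⟩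

theorem nnratEnum (hF : UniformlyComputable F) :
    UniformlyComputableRat fun p a => nnratEnum (F p a) :=
  ⟨_, _, _, hF.unpair_fst, .const 0, hF.unpair_snd, fun _ _ => by simp [Weih.nnratEnum]⟩

protected theorem const (q : ℚ) : UniformlyComputableRat fun _ (_ : α) => q := by
  obtain ⟨k, rfl⟩ := ratEnum_surjective q
  exact ratEnum (.const k)

theorem natCast (hF : UniformlyComputable F) : UniformlyComputableRat fun p a => (F p a : ℚ) :=
  ⟨_, _, _, hF, .const 0, .const 0, fun _ _ => by simp⟩

theorem comp {r : Baire → β → ℚ} {G : Baire → α → β} (hr : UniformlyComputableRat r)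
    (hG : UniformlyComputable G) : UniformlyComputableRat fun p a => r p (G p a) := by
  obtain ⟨u, v, w, hu, hv, hw, h⟩ := hr
  exact ⟨_, _, _, hu.comp hG, hv.comp hG, hw.comp hG, fun p a => h p (G p a)⟩

protected theorem sub (hr : UniformlyComputableRat r) (hs : UniformlyComputableRat s) :
    UniformlyComputableRat fun p a => r p a - s p a := by
  obtain ⟨u, v, w, hu, hv, hw, h⟩ := hr
  obtain ⟨u', v', w', hu', hv', hw', h'⟩ := hs
  refine ⟨_, _, _, (hu.mul (hw'.add (.const 1))).add (hv'.mul (hw.add (.const 1))),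
    (hv.mul (hw'.add (.const 1))).add (hu'.mul (hw.add (.const 1))),
    (hw.mul hw').add (hw.add hw'), fun p a => ?_⟩
  beta_reduce
  rw [h, h', div_sub_div _ _ (by positivity) (by positivity)]
  push_cast
  ring

protected theorem add (hr : UniformlyComputableRat r) (hs : UniformlyComputableRat s) :
    UniformlyComputableRat fun p a => r p a + s p a := by
  simpa only [zero_sub, sub_neg_eq_add] using hr.sub ((UniformlyComputableRat.const 0).sub hs)

protected theorem mul (hr : UniformlyComputableRat r) (hs : UniformlyComputableRat s) :
    UniformlyComputableRat fun p a => r p a * s p a := by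
  obtain ⟨u, v, w, hu, hv, hw, h⟩ := hr
  obtain ⟨u', v', w', hu', hv', hw', h'⟩ := hs
  refine ⟨_, _, _, (hu.mul hu').add (hv.mul hv'), (hu.mul hv').add (hv.mul hu'),
    (hw.mul hw').add (hw.add hw'), fun p a => ?_⟩
  beta_reduce
  rw [h, h', div_mul_div_comm]
  push_cast
  ring

theorem inv_natCast (hF : UniformlyComputable F) :
    UniformlyComputableRat fun p a => (F p a : ℚ)⁻¹ := by
  -- The numerator `1 - (1 - F p a)` takes care of the value `0⁻¹ = 0`.
  refine ⟨_, _, _, .sub (.const 1) (.sub (.const 1) hF), .const 0, hF.sub (.const 1),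
    fun p a => ?_⟩
  rcases h : F p a with _ | m <;> simp [h]

theorem two_inv_pow (hF : UniformlyComputable F) :
    UniformlyComputableRat fun p a => (2⁻¹ : ℚ) ^ F p a := by
  simpa using inv_natCast (.pow (.const 2) hF)

theorem div_natCast (hr : UniformlyComputableRat r) (hF : UniformlyComputable F) :
    UniformlyComputableRat fun p a => r p a / F p a :=
  hr.mul (inv_natCast hF)

open Classical in
theorem ite {P : Baire → α → Prop} (hP : UniformlyDecidable P) (hr : UniformlyComputableRat r)
    (hs : UniformlyComputableRat s) :
    UniformlyComputableRat fun p a => if P p a then r p a else s p a := by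
  obtain ⟨u, v, w, hu, hv, hw, h⟩ := hr
  obtain ⟨u', v', w', hu', hv', hw', h'⟩ := hs
  refine ⟨_, _, _, hP.ite hu hu', hP.ite hv hv', hP.ite hw hw', fun p a => ?_⟩
  beta_reduce
  split_ifs
  · exact h p a
  · exact h' p a

theorem lt (hr : UniformlyComputableRat r) (hs : UniformlyComputableRat s) :
    UniformlyDecidable fun p a => r p a < s p a := by
  obtain ⟨u, v, w, hu, hv, -, h⟩ := hs.sub hr
  beta_reduce at h
  have hiff : ∀ p a, r p a < s p a ↔ v p a < u p a := fun p a => by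
    have hw : (0 : ℚ) < w p a + 1 := by positivity
    rw [← sub_pos, h, div_pos_iff_of_pos_right hw, sub_pos, Nat.cast_lt]
  simpa only [hiff] using UniformlyDecidable.lt hv hu

theorem natFloor (hr : UniformlyComputableRat r) :
    UniformlyComputable fun p a => ⌊r p a⌋₊ := by
  obtain ⟨u, v, w, hu, hv, hw, h⟩ := hr
  have hfloor : ∀ p a, ⌊r p a⌋₊ = (u p a - v p a) / (w p a + 1) := fun p a => by
    rw [h, ← Nat.cast_succ, Nat.floor_div_natCast, Nat.floor_sub_natCast, Nat.floor_natCast]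
  simpa only [hfloor] using (hu.sub hv).div (hw.add (.const 1))

theorem exists_ratEnum_eq (hr : UniformlyComputableRat r) :
    ∃ g : Baire → α → ℕ, UniformlyComputable g ∧ ∀ p a, Weih.ratEnum (g p a) = r p a := by
  obtain ⟨u, v, w, hu, hv, hw, h⟩ := hr
  exact ⟨_, (hu.natPair hv).natPair hw, fun p a => by simp [Weih.ratEnum, h]⟩

theorem exists_nnratEnum_eq (hr : UniformlyComputableRat r) :
    ∃ g : Baire → α → ℕ, UniformlyComputable g ∧ ∀ p a, Weih.nnratEnum (g p a) = max (r p a) 0 := by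
  obtain ⟨u, v, w, hu, hv, hw, h⟩ := hr
  refine ⟨_, (hu.sub hv).natPair hw, fun p a => ?_⟩
  have hsub : ((u p a - v p a : ℕ) : ℚ) = max ((u p a : ℚ) - v p a) 0 := by
    rcases le_total (v p a) (u p a) with h | h <;> simp [h]
  rw [h, ← zero_div ((w p a : ℚ) + 1), max_div_div_right (by positivity), ← hsub]
  simp [Weih.nnratEnum]

theorem exists_basicBall_eq_Ioo (hr : UniformlyComputableRat r) (hs : UniformlyComputableRat s) :
    ∃ g : Baire → α → ℕ, UniformlyComputable g ∧
      ∀ p a, (basicBall (g p a) : Set ℝ) = Set.Ioo (r p a : ℝ) (s p a) := by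
  obtain ⟨c, hc, hcenter⟩ := ((hr.add hs).mul (.const 2⁻¹)).exists_ratEnum_eq
  obtain ⟨d, hd, hradius⟩ := ((hs.sub hr).mul (.const 2⁻¹)).exists_nnratEnum_eq
  refine ⟨_, hc.natPair hd, fun p a => ?_⟩
  have hpt : (ComputableMetricSpace.pt (c p a) : ℝ) = (r p a + s p a) / 2 := by
    change (Weih.ratEnum (c p a) : ℝ) = _
    rw [hcenter]
    push_cast
    ring
  rw [basicBall, Nat.unpair_pair, hpt, hradius, Real.Ioo_eq_ball]
  rcases le_total (r p a) (s p a) with h | h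
  · rw [max_eq_left (by linarith)]
    push_cast
    ring_nf
  · have h' : ((s p a : ℝ) - r p a) / 2 ≤ 0 := by
      have : (s p a : ℝ) ≤ r p a := by exact_mod_cast h
      linarith
    rw [max_eq_right (by linarith), Metric.ball_eq_empty.2 h', Rat.cast_zero, Metric.ball_zero]

end UniformlyComputableRat

section RatPointDist

variable {α : Type} [Primcodable α] {n : ℕ} {i j : Baire → α → ℕ}

theorem exists_dist_ratPoint_eq_sqrt (hi : UniformlyComputable i) (hj : UniformlyComputable j) :
    ∃ s : Baire → α → ℚ, UniformlyComputableRat s ∧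
      ∀ p a, dist (ratPoint n (i p a)) (ratPoint n (j p a)) = √(s p a) := by
  have hsq : UniformlyComputable fun p a => sqDist (i p a) (j p a) n :=
    .map₂ (sqDist_primrec n) hi hj
  refine ⟨_, .div_natCast (.natCast (.map .fst hsq)) (.map .snd hsq), fun p a => ?_⟩
  rw [sqDist_spec]
  push_cast
  rfl

theorem uniformlyDecidable_dist_ratPoint_lt {r : Baire → α → ℚ} (hi : UniformlyComputable i)
    (hj : UniformlyComputable j) (hr : UniformlyComputableRat r) :
    UniformlyDecidable fun p a => dist (ratPoint n (i p a)) (ratPoint n (j p a)) < r p a := by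
  obtain ⟨s, hs, hdist⟩ := exists_dist_ratPoint_eq_sqrt (n := n) hi hj
  have hiff : ∀ p a, dist (ratPoint n (i p a)) (ratPoint n (j p a)) < r p a ↔
      0 < r p a ∧ s p a < r p a * r p a := fun p a => by
    rw [hdist p a]
    constructor
    · intro h
      have hpos := (Real.sqrt_nonneg _).trans_lt h
      rw [Real.sqrt_lt' hpos, sq] at h
      exact_mod_cast And.intro hpos h
    · rintro ⟨hpos, h⟩
      rw [Real.sqrt_lt' (by exact_mod_cast hpos), sq]
      exact_mod_cast h
  simpa only [hiff] using ((UniformlyComputableRat.const 0).lt hr).and (hs.lt (hr.mul hr))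

theorem uniformlyDecidable_lt_dist_ratPoint {r : Baire → α → ℚ} (hi : UniformlyComputable i)
    (hj : UniformlyComputable j) (hr : UniformlyComputableRat r) :
    UniformlyDecidable fun p a => (r p a : ℝ) < dist (ratPoint n (i p a)) (ratPoint n (j p a)) := by
  obtain ⟨s, hs, hdist⟩ := exists_dist_ratPoint_eq_sqrt (n := n) hi hj
  have hiff : ∀ p a, r p a < dist (ratPoint n (i p a)) (ratPoint n (j p a)) ↔
      r p a < 0 ∨ r p a * r p a < s p a := fun p a => by
    rw [hdist p a]
    rcases lt_or_ge (r p a) 0 with hneg | hnonneg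
    · have : (r p a : ℝ) < 0 := by exact_mod_cast hneg
      exact iff_of_true (this.trans_le (Real.sqrt_nonneg _)) (.inl hneg)
    · rw [Real.lt_sqrt (by exact_mod_cast hnonneg), sq, or_iff_right hnonneg.not_gt]
      exact_mod_cast Iff.rfl
  simpa only [hiff] using (hr.lt (.const 0)).or ((hr.mul hr).lt hs)

end RatPointDist

/-! ### Strong reductions by total functions -/

theorem strongReducible_of_uniformlyComputable {f g : Problem} {H K : Baire → Baire}
    (hH : UniformlyComputable H) (hK : UniformlyComputable K)
    (h : ∀ p x, f.inRep.Names p x → (f.values x).Nonempty →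
      ∃ a, g.inRep.Names (K p) a ∧ (g.values a).Nonempty ∧
        ∀ b ∈ g.values a, ∀ q, g.outRep.Names q b → ∃ y ∈ f.values x, f.outRep.Names (H q) y) :
    StrongReducible f g := by
  refine ⟨_, _, hH.isComputable, hK.isComputable, fun G hG p x hp hx => ?_⟩
  obtain ⟨a, ha, hne, hsol⟩ := h p x hp hx
  obtain ⟨q, hq, b, hb, hqb⟩ := hG _ a ha hne
  obtain ⟨y, hy, hHq⟩ := hsol b hb q hqb
  refine ⟨H q, ?_, y, hy, hHq⟩
  simp only [Part.bind_some, Part.mem_bind_iff, Part.mem_some_iff]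
  exact ⟨q, hq, rfl⟩

theorem dist_pt_le_of_names {X : Type} [MetricSpace X] [ComputableMetricSpace X] {p : Baire}
    {x : X} (h : (cauchyRep X).Names p x) (i : ℕ) :
    dist (ComputableMetricSpace.pt (X := X) (p i)) x ≤ 2⁻¹ ^ i := by
  refine le_of_tendsto (tendsto_const_nhds.dist h.2) ?_
  filter_upwards [Filter.eventually_ge_atTop i] with j hj using h.1 i j hj

/-! ### Trees of digit expansions as closed sets of real numbers -/

/-- The numbers `x ≥ 0` such that, for every `k`, the fractional part of `B ^ k * x` is at most
one half and the integral part `N` of `B ^ k * x` is not excluded by `P (k, N)`. The restriction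
on the fractional parts is what makes the digits of `x` computable from `x`. -/
def digitSet (B : ℕ) (P : ℕ × ℕ → Prop) : Set ℝ :=
  {x | 0 ≤ x ∧ ∀ k, Int.fract ((B : ℝ) ^ k * x) ≤ 1 / 2 ∧ ¬P (k, ⌊(B : ℝ) ^ k * x⌋₊)}

/-- A branch of the forest on `ℕ × ℕ` in which the children of `(k, N)` are the nodes
`(k + 1, B * N + d)` with `d < B`. -/
def IsBranch (B : ℕ) (N : ℕ → ℕ) : Prop := ∀ k, N (k + 1) / B = N k

theorem isBranch_natFloor {B : ℕ} (hB : 0 < B) (x : ℝ) :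
    IsBranch B fun k => ⌊(B : ℝ) ^ k * x⌋₊ := fun k => by
  have hB' : (B : ℝ) ≠ 0 := by positivity
  rw [← Nat.floor_div_natCast, pow_succ', mul_assoc, mul_div_cancel_left₀ _ hB']

section DigitGaps

open Classical in
/-- The numbers which are kept out of the interval `[z, z + 1]` by `digitSet`: its second half if
`P z` fails, and all of `[z, z + 1)` if `P z` holds. -/
noncomputable def digitGapLeft (P : ℤ → Prop) (z : ℤ) : ℚ := z + if P z then -2⁻¹ else 2⁻¹

theorem fract_le_half_and_not_floor_iff {P : ℤ → Prop} {y : ℝ} :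
    Int.fract y ≤ 1 / 2 ∧ ¬P ⌊y⌋ ↔ ∀ z : ℤ, y ∉ Set.Ioo (digitGapLeft P z : ℝ) (z + 1) := by
  have hy : (⌊y⌋ : ℝ) + Int.fract y = y := Int.floor_add_fract y
  have hnonneg := Int.fract_nonneg y
  constructor
  · rintro ⟨hfract, hfloor⟩ z ⟨hl, hr⟩
    have hz : ⌊y⌋ ≤ z := Int.lt_add_one_iff.1 (Int.floor_lt.2 (by push_cast; exact hr))
    rcases hz.lt_or_eq with hz | rfl
    · have hz' : (⌊y⌋ : ℝ) + 1 ≤ z := by exact_mod_cast hz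
      have : (z : ℝ) - 2⁻¹ ≤ digitGapLeft P z := by
        unfold digitGapLeft
        split_ifs <;> push_cast <;> linarith
      linarith
    · rw [digitGapLeft, if_neg hfloor] at hl
      push_cast at hl
      linarith
  · intro h
    have hleft : y ≤ digitGapLeft P ⌊y⌋ := by
      simpa only [Set.mem_Ioo, Int.lt_floor_add_one, and_true, not_lt] using h ⌊y⌋
    rw [digitGapLeft] at hleft
    split_ifs at hleft with hP <;> push_cast at hleft
    · linarith
    · exact ⟨by linarith, hP⟩

end DigitGaps

section DigitSet

variable {B : ℕ} {P : ℕ × ℕ → Prop}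

theorem mem_digitSet_iff {x : ℝ} :
    x ∈ digitSet B P ↔ ∀ (k : ℕ) (z : ℤ), (B : ℝ) ^ k * x ∉
      Set.Ioo (digitGapLeft (fun z => z < 0 ∨ P (k, z.toNat)) z : ℝ) (z + 1) := by
  simp only [← fract_le_half_and_not_floor_iff, not_or, Int.floor_toNat, not_lt, Int.floor_nonneg]
  constructor
  · rintro ⟨hx, h⟩ k
    exact ⟨(h k).1, by positivity, (h k).2⟩
  · intro h
    exact ⟨by simpa using (h 0).2.1, fun k => ⟨(h k).1, (h k).2.2⟩⟩

theorem uniformlyComputableRat_digitGapLeft {P : Baire → ℕ × ℕ → Prop}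
    (hP : UniformlyDecidable P) :
    UniformlyComputableRat fun p (i : ℕ × ℕ × ℕ) =>
      digitGapLeft (fun z => z < 0 ∨ P p (i.1, z.toNat)) ((i.2.1 : ℤ) - (i.2.2 : ℤ)) := by
  have hk : UniformlyComputable fun _ (i : ℕ × ℕ × ℕ) => i.1 := .fst
  have ha : UniformlyComputable fun _ (i : ℕ × ℕ × ℕ) => i.2.1 := .comp .fst .snd
  have hb : UniformlyComputable fun _ (i : ℕ × ℕ × ℕ) => i.2.2 := .comp .snd .snd
  have hcond := (UniformlyDecidable.lt ha hb).or (hP.comp (hk.pair (ha.sub hb)))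
  have hiff (p : Baire) (i : ℕ × ℕ × ℕ) : ((i.2.1 : ℤ) - (i.2.2 : ℤ) < 0 ∨
      P p (i.1, ((i.2.1 : ℤ) - (i.2.2 : ℤ)).toNat)) ↔ i.2.1 < i.2.2 ∨ P p (i.1, i.2.1 - i.2.2) := by
    rw [Int.toNat_sub, sub_neg, Nat.cast_lt]
  convert ((UniformlyComputableRat.natCast ha).sub (.natCast hb)).add
      (.ite hcond (.const (-2⁻¹)) (.const 2⁻¹)) using 3 with p i
  rw [digitGapLeft, Int.cast_sub, Int.cast_natCast, Int.cast_natCast]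
  congr 2
  exact propext (hiff p i)

theorem exists_negRep_name_digitSet {P : Baire → ℕ × ℕ → Prop} (hB : 0 < B)
    (hP : UniformlyDecidable P) :
    ∃ K : Baire → Baire, UniformlyComputable K ∧
      ∀ p, digitSet B (P p) = (⋃ i, basicBall (K p i))ᶜ := by
  have hBpow : UniformlyComputable fun _ (i : ℕ × ℕ × ℕ) => B ^ i.1 := .pow (.const B) .fst
  have hright : UniformlyComputableRat fun _ (i : ℕ × ℕ × ℕ) => (i.2.1 - i.2.2 + 1 : ℚ) :=
    .add (.sub (.natCast (.comp .fst .snd)) (.natCast (.comp .snd .snd))) (.const 1)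
  obtain ⟨g, hg, hball⟩ := ((uniformlyComputableRat_digitGapLeft hP).div_natCast
    hBpow).exists_basicBall_eq_Ioo (hright.div_natCast hBpow)
  refine ⟨_, hg.comp (.of_primrec (Primrec.ofNat (ℕ × ℕ × ℕ))), fun p => Set.ext fun x => ?_⟩
  have hscale (k : ℕ) (l r : ℝ) :
      (B : ℝ) ^ k * x ∈ Set.Ioo l r ↔ x ∈ Set.Ioo (l / (B : ℝ) ^ k) (r / (B : ℝ) ^ k) := by
    rw [Set.mem_Ioo, Set.mem_Ioo, div_lt_iff₀' (by positivity), lt_div_iff₀' (by positivity)]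
  have hsub : Function.Surjective fun i : ℕ × ℕ => (i.1 : ℤ) - (i.2 : ℤ) :=
    fun z => ⟨(z.toNat, (-z).toNat), Int.toNat_sub_toNat_neg z⟩
  have hindex : Function.Surjective (Denumerable.ofNat (ℕ × ℕ × ℕ)) :=
    (Denumerable.eqv (ℕ × ℕ × ℕ)).symm.surjective
  rw [mem_digitSet_iff, Set.mem_compl_iff, Set.mem_iUnion, not_exists,
    ← hindex.forall (p := fun i => x ∉ basicBall (g p i))]
  simp only [hball, hscale, hsub.forall, Prod.forall, Rat.cast_div, Rat.cast_add, Rat.cast_sub,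
    Rat.cast_natCast, Rat.cast_one, Rat.cast_pow, Nat.cast_pow, Int.cast_sub, Int.cast_natCast]

theorem exists_forall_mem_Icc_of_isBranch {b : ℕ} {N : ℕ → ℕ} (hb : 0 < b)
    (hN : IsBranch (2 * b) N) (hdigit : ∀ k, N (k + 1) % (2 * b) < b) :
    ∃ x : ℝ, ∀ k, ((2 * b : ℕ) : ℝ) ^ k * x ∈ Set.Icc (N k : ℝ) (N k + 1 / 2) := by
  set B : ℝ := ((2 * b : ℕ) : ℝ) with hBdef
  have hB (k : ℕ) : 0 < B ^ k := by positivity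
  have hstep (k : ℕ) : B * N k ≤ N (k + 1) ∧ N (k + 1) + 1 / 2 ≤ B * (N k + 1 / 2) := by
    have hlt : (N (k + 1) % (2 * b) : ℕ) + (1 : ℝ) ≤ b := by exact_mod_cast hdigit k
    have hdivmod : B * N k + (N (k + 1) % (2 * b) : ℕ) = N (k + 1) := by
      rw [hBdef, ← hN k]
      exact_mod_cast Nat.div_add_mod _ _
    have hB2 : B = 2 * b := by push_cast [hBdef]; ring
    constructor <;> linarith [Nat.cast_nonneg (α := ℝ) (N (k + 1) % (2 * b))]
  have hanti : Antitone fun k => Set.Icc (N k / B ^ k) ((N k + 1 / 2) / B ^ k) := by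
    refine antitone_nat_of_succ_le fun k => Set.Icc_subset_Icc ?_ ?_
    · rw [div_le_div_iff₀ (hB _) (hB _), pow_succ']
      nlinarith [(hstep k).1, hB k]
    · rw [div_le_div_iff₀ (hB _) (hB _), pow_succ']
      nlinarith [(hstep k).2, hB k]
  have hmem := ciSup_mem_iInter_Icc_of_antitone_Icc hanti
    fun k => div_le_div_of_nonneg_right (by linarith) (hB k).le
  refine ⟨⨆ k, N k / B ^ k, fun k => ?_⟩
  have hk := Set.mem_iInter.1 hmem k
  rwa [Set.mem_Icc, div_le_iff₀' (hB k), le_div_iff₀' (hB k)] at hk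

theorem digitSet_nonempty_of_isBranch {b : ℕ} {N : ℕ → ℕ} (hb : 0 < b) (hN : IsBranch (2 * b) N)
    (hdigit : ∀ k, N (k + 1) % (2 * b) < b) (hP : ∀ k, ¬P (k, N k)) :
    (digitSet (2 * b) P).Nonempty := by
  obtain ⟨x, hx⟩ := exists_forall_mem_Icc_of_isBranch hb hN hdigit
  have hfloor (k : ℕ) : ⌊((2 * b : ℕ) : ℝ) ^ k * x⌋ = (N k : ℤ) :=
    Int.floor_eq_iff.2 ⟨(hx k).1, (hx k).2.trans_lt (by push_cast; linarith)⟩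
  refine ⟨x, (Nat.cast_nonneg (N 0)).trans (by simpa using (hx 0).1), fun k => ⟨?_, ?_⟩⟩
  · rw [Int.fract, hfloor, Int.cast_natCast]
    linarith [(hx k).2]
  · rw [← Int.floor_toNat, hfloor]
    exact hP k

theorem natFloor_eq_of_mem_digitSet {x a : ℝ} {k : ℕ} (hx : x ∈ digitSet B P)
    (ha : |a - (B : ℝ) ^ k * x| < 1 / 4) : ⌊a + 1 / 4⌋₊ = ⌊(B : ℝ) ^ k * x⌋₊ := by
  have hnonneg : (0 : ℝ) ≤ (B : ℝ) ^ k * x := mul_nonneg (by positivity) hx.1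
  have hfloor : (⌊(B : ℝ) ^ k * x⌋₊ : ℝ) + Int.fract ((B : ℝ) ^ k * x) = (B : ℝ) ^ k * x := by
    rw [natCast_floor_eq_intCast_floor hnonneg, Int.floor_add_fract]
  have hfract := (hx.2 k).1
  have hfract' := Int.fract_nonneg ((B : ℝ) ^ k * x)
  rw [abs_lt] at ha
  rw [Nat.floor_eq_iff (by linarith)]
  constructor <;> linarith

/-- The digits of a point of a digit set, read off a name `q` of the point. -/
noncomputable def readDigits (B : ℕ) (q : Baire) (k : ℕ) : ℕ :=
  ⌊(B : ℚ) ^ k * ratEnum (q (B * k + 3)) + 1 / 4⌋₊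

theorem uniformlyComputable_readDigits (B : ℕ) : UniformlyComputable (readDigits B) := by
  have hB : UniformlyComputableRat fun _ (k : ℕ) => (B : ℚ) ^ k := by
    simpa only [Nat.cast_pow] using UniformlyComputableRat.natCast (.pow (.const B) .id)
  exact ((hB.mul (.ratEnum (.oracle (.add (.mul (.const B) .id) (.const 3))))).add
    (.const (1 / 4))).natFloor

theorem readDigits_eq_natFloor {q : Baire} {x : ℝ} (hx : x ∈ digitSet B P)
    (hq : (cauchyRep ℝ).Names q x) (k : ℕ) : readDigits B q k = ⌊(B : ℝ) ^ k * x⌋₊ := by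
  have hdist : |(ratEnum (q (B * k + 3)) : ℝ) - x| ≤ 2⁻¹ ^ (B * k + 3) :=
    dist_pt_le_of_names hq (B * k + 3)
  have hB : (B : ℝ) ^ k ≤ 2 ^ (B * k) := by
    rw [pow_mul]
    exact pow_le_pow_left₀ (by positivity) (by exact_mod_cast Nat.lt_two_pow_self.le) k
  rw [← natFloor_eq_of_mem_digitSet hx (a := B ^ k * ratEnum (q (B * k + 3))), readDigits]
  · rw [← Int.floor_toNat, ← Int.floor_toNat, ← Rat.floor_cast (α := ℝ)]
    push_cast
    rfl
  · rw [← mul_sub, abs_mul, abs_of_nonneg (by positivity)]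
    calc (B : ℝ) ^ k * |(ratEnum (q (B * k + 3)) : ℝ) - x|
        ≤ 2 ^ (B * k) * 2⁻¹ ^ (B * k + 3) := by gcongr
      _ = 1 / 8 := by rw [pow_add, ← mul_assoc, ← mul_pow]; norm_num
      _ < 1 / 4 := by norm_num

end DigitSet

theorem strongReducible_closedChoice_real_of_branches {f : Problem} {b : ℕ}
    {P : Baire → ℕ × ℕ → Prop} {D : Baire → Baire} (hb : 0 < b) (hP : UniformlyDecidable P)
    (hD : UniformlyComputable D)
    (hbranch : ∀ p x, f.inRep.Names p x → (f.values x).Nonempty →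
      ∃ N, IsBranch (2 * b) N ∧ (∀ k, N (k + 1) % (2 * b) < b) ∧ ∀ k, ¬P p (k, N k))
    (hdecode : ∀ p x, f.inRep.Names p x → (f.values x).Nonempty →
      ∀ N, IsBranch (2 * b) N → (∀ k, ¬P p (k, N k)) →
        ∃ y ∈ f.values x, f.outRep.Names (D N) y) :
    StrongReducible f (closedChoice ℝ) := by
  have h2b : 0 < 2 * b := by positivity
  obtain ⟨K, hK, hname⟩ := exists_negRep_name_digitSet h2b hP
  refine strongReducible_of_uniformlyComputable
    (hD.substitute (uniformlyComputable_readDigits (2 * b))) hK fun p x hp hx => ?_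
  obtain ⟨N, hN, hdigit, hNP⟩ := hbranch p x hp hx
  have hclosed : IsClosed (digitSet (2 * b) (P p)) := by
    rw [hname]
    exact (isOpen_iUnion fun _ => Metric.isOpen_ball).isClosed_compl
  refine ⟨⟨digitSet (2 * b) (P p), hclosed⟩, hname p,
    digitSet_nonempty_of_isBranch hb hN hdigit hNP, fun z hz q hq => ?_⟩
  have hfloor := funext (readDigits_eq_natFloor hz hq)
  rw [hfloor]
  exact hdecode p x hp hx _ (isBranch_natFloor h2b z) fun k => (hz.2 k).2

/-! ### Refuting approximate projection points -/

section Rejection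

open ComputableMetricSpace (pt)

variable {X : Type} [MetricSpace X] [ComputableMetricSpace X]

theorem tendsto_two_inv_pow : Filter.Tendsto (fun k : ℕ => (2⁻¹ : ℝ) ^ k) Filter.atTop (𝓝 0) :=
  tendsto_pow_atTop_nhds_zero_of_lt_one (by norm_num) (by norm_num)

theorem cauchyRep_names_of_dist_le {p : Baire} {x : X}
    (h : ∀ i, dist (pt (X := X) (p i)) x ≤ 2⁻¹ ^ (i + 1)) :
    (cauchyRep X).Names p x := by
  refine ⟨fun i j hij => ?_, ?_⟩
  · calc dist (pt (X := X) (p i)) (pt (p j))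
        ≤ 2⁻¹ ^ (i + 1) + 2⁻¹ ^ (j + 1) :=
          (dist_triangle_right _ _ x).trans (add_le_add (h i) (h j))
      _ ≤ 2⁻¹ ^ (i + 1) + 2⁻¹ ^ (i + 1) := by
          gcongr _ + ?_
          exact pow_le_pow_of_le_one (by norm_num) (by norm_num) (by omega)
      _ = 2⁻¹ ^ i := by ring
  · exact tendsto_iff_dist_tendsto_zero.2 <| squeeze_zero (fun _ => dist_nonneg) h
      (tendsto_two_inv_pow.comp (Filter.tendsto_add_atTop_nat 1))

/-- The first `k` entries of a name `b` of a closed set `A` and the `k`-th entry of a name `p` of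
a point `x` suffice to see that the closed ball with centre `c` and radius `δ` contains no point
of `A` whose distance from `x` is at most `r`. -/
def Rejected (p b : Baire) (k : ℕ) (c : X) (δ r : ℝ) : Prop :=
  (∃ i < k, dist (pt (b i).unpair.1) c < nnratEnum (b i).unpair.2 - δ) ∨
    r + 2⁻¹ ^ k + δ < dist (pt (p k)) c

variable {p b : Baire} {x y : X} {A : TopologicalSpace.Closeds X} {r : ℝ}

theorem not_rejected_of_dist_le (hp : (cauchyRep X).Names p x) (hb : (negRep X).Names b A)
    (hy : y ∈ A) (hxy : dist x y ≤ r) {k : ℕ} {c : X} {δ : ℝ} (hc : dist c y ≤ δ) :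
    ¬Rejected p b k c δ r := by
  rintro (⟨i, -, hi⟩ | hk)
  · have hyi : y ∉ basicBall (b i) := fun h => by
      have : y ∈ (⋃ i, basicBall (b i))ᶜ := hb ▸ hy
      exact this (Set.mem_iUnion.2 ⟨i, h⟩)
    refine hyi (Metric.mem_ball'.2 ?_)
    linarith [dist_triangle (pt (b i).unpair.1) c y]
  · have := dist_triangle4 (pt (p k)) x y c
    linarith [dist_pt_le_of_names hp k, dist_comm c y]

theorem mem_and_dist_le_of_forall_not_rejected (hp : (cauchyRep X).Names p x)
    (hb : (negRep X).Names b A) {c : ℕ → X} {δ : ℕ → ℝ} (hδ : Filter.Tendsto δ Filter.atTop (𝓝 0))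
    (hc : ∀ k, dist (c k) y ≤ δ k) (h : ∀ k, ¬Rejected p b k (c k) (δ k) r) :
    y ∈ A ∧ dist x y ≤ r := by
  have hcy : Filter.Tendsto c Filter.atTop (𝓝 y) :=
    tendsto_iff_dist_tendsto_zero.2 (squeeze_zero (fun _ => dist_nonneg) hc hδ)
  simp only [Rejected, not_or, not_exists, not_and, not_lt] at h
  constructor
  · have hball (i : ℕ) : y ∉ basicBall (b i) := fun hi => by
      refine (Metric.mem_ball'.1 hi).not_ge (le_of_tendsto_of_tendsto
        (by simpa using tendsto_const_nhds.sub hδ) (tendsto_const_nhds.dist hcy) ?_)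
      filter_upwards [Filter.eventually_gt_atTop i] with k hk using (h k).1 i hk
    change y ∈ (A : Set X)
    rw [show (A : Set X) = (⋃ i, basicBall (b i))ᶜ from hb]
    simpa only [Set.mem_compl_iff, Set.mem_iUnion, not_exists] using hball
  · refine le_of_tendsto_of_tendsto' (hp.2.dist hcy) ?_ fun k => (h k).2
    simpa using (tendsto_two_inv_pow.const_add r).add hδ

theorem eventually_rejected_of_notMem (hb : (negRep X).Names b A) {δ : ℕ → ℝ}
    (hδ : Filter.Tendsto δ Filter.atTop (𝓝 0)) (hy : y ∉ A) (p : Baire) (r : ℝ) :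
    ∀ᶠ z : ℕ × X in Filter.atTop ×ˢ 𝓝 y, Rejected p b z.1 z.2 (δ z.1) r := by
  obtain ⟨i, hi⟩ : ∃ i, y ∈ basicBall (b i) := by
    have : y ∈ (A : Set X)ᶜ := hy
    rwa [show (A : Set X) = (⋃ i, basicBall (b i))ᶜ from hb, compl_compl, Set.mem_iUnion] at this
  have hlim : Filter.Tendsto (fun z : ℕ × X => dist (pt (b i).unpair.1) z.2 + δ z.1)
      (Filter.atTop ×ˢ 𝓝 y) (𝓝 (dist (pt (b i).unpair.1) y + 0)) :=
    (tendsto_const_nhds.dist Filter.tendsto_snd).add (hδ.comp Filter.tendsto_fst)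
  rw [add_zero] at hlim
  filter_upwards [hlim.eventually_lt_const (Metric.mem_ball'.1 hi),
    Filter.tendsto_fst.eventually (Filter.eventually_gt_atTop i)] with z hz hik
  exact .inl ⟨i, hik, lt_sub_iff_add_lt.2 hz⟩

theorem eventually_forall_rejected [ProperSpace X] (hp : (cauchyRep X).Names p x)
    (hb : (negRep X).Names b A) {δ : ℕ → ℝ} (hδ : Filter.Tendsto δ Filter.atTop (𝓝 0))
    (hr : r < Metric.infDist x A) : ∀ᶠ k in Filter.atTop, ∀ c : X, Rejected p b k c (δ k) r := by
  obtain ⟨s, hrs, hs⟩ := exists_between hr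
  have hball : ∀ y ∈ Metric.closedBall x s, y ∉ A := fun y hy hyA =>
    (Metric.infDist_le_dist_of_mem hyA).not_gt ((Metric.mem_closedBall'.1 hy).trans_lt hs)
  have hnear : ∀ᶠ z : ℕ × X in Filter.atTop ×ˢ 𝓝ˢ (Metric.closedBall x s),
      Rejected p b z.1 z.2 (δ z.1) r :=
    (isCompact_closedBall x s).mem_prod_nhdsSet_of_forall fun y hy =>
      eventually_rejected_of_notMem hb hδ (hball y hy) p r
  have hmargin : Filter.Tendsto (fun k => r + 2⁻¹ ^ k + δ k + 2⁻¹ ^ k) Filter.atTop (𝓝 r) := by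
    simpa using ((tendsto_two_inv_pow.const_add r).add hδ).add tendsto_two_inv_pow
  filter_upwards [hnear.curry, hmargin.eventually_lt_const hrs] with k hnear hk c
  by_cases hc : c ∈ Metric.closedBall x s
  · exact hnear.self_of_nhdsSet c hc
  · rw [Metric.mem_closedBall', not_le] at hc
    refine .inr ?_
    linarith [dist_triangle_left x c (pt (X := X) (p k)), dist_pt_le_of_names hp k]

end Rejection

/-! ### Nested cubes given by digit expansions -/

section Cells

variable {n : ℕ}

theorem UniformlyComputable.listOfFn {α σ : Type} [Primcodable α] [Primcodable σ]
    {F : Fin n → Baire → α → σ} (hF : ∀ j, UniformlyComputable (F j)) :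
    UniformlyComputable fun p a => List.ofFn fun j => F j p a := by
  induction n with
  | zero => exact .const []
  | succ n ih => simpa only [List.ofFn_succ] using .map₂ .list_cons (hF 0) (ih fun j => hF j.succ)

theorem exists_ratPoint_eq {α : Type} [Primcodable α] {r : Fin n → Baire → α → ℚ}
    (hr : ∀ j, UniformlyComputableRat (r j)) :
    ∃ g : Baire → α → ℕ, UniformlyComputable g ∧ ∀ p a j, ratPoint n (g p a) j = r j p a := by
  choose g hg hgr using fun j => (hr j).exists_ratEnum_eq
  exact ⟨_, .map .encode (.listOfFn hg), fun p a j => by simp [ratPoint, List.getD, hgr]⟩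

theorem dist_le_mul_of_forall_abs_sub_le {x y : EuclideanSpace ℝ (Fin n)} {c : ℝ}
    (h : ∀ j, |x j - y j| ≤ c) : dist x y ≤ n * c :=
  calc dist x y = √(∑ j, |x j - y j| ^ 2) := EuclideanSpace.dist_eq x y
    _ ≤ ∑ j, |x j - y j| :=
        Real.sqrt_le_iff.2 ⟨Finset.sum_nonneg fun _ _ => abs_nonneg _,
          Finset.sum_sq_le_sq_sum_of_nonneg fun _ _ => abs_nonneg _⟩
    _ ≤ ∑ _j : Fin n, c := Finset.sum_le_sum fun j _ => h j
    _ = n * c := by simp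

theorem IsBranch.div_pow {B : ℕ} {N : ℕ → ℕ} (hN : IsBranch B N) (k : ℕ) : N k / B ^ k = N 0 := by
  induction k with
  | zero => simp
  | succ k ih => rw [pow_succ', ← Nat.div_div_eq_div_mul, hN, ih]

/-- The last `k` digits of `N` in base `2 * 2 ^ n` encode a vertex of the grid `{0, …, 2 ^ k - 1}ⁿ`:
the `j`-th binary digits of these digits, read as a binary expansion, give its `j`-th
coordinate. -/
def cellCoord (n j k N : ℕ) : ℕ :=
  ∑ i ∈ Finset.range k, 2 ^ i * (N / (2 * 2 ^ n) ^ i / 2 ^ j % 2)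

theorem cellCoord_succ (n j k N : ℕ) :
    cellCoord n j (k + 1) N = 2 * cellCoord n j k (N / (2 * 2 ^ n)) + N / 2 ^ j % 2 := by
  simp only [cellCoord, Finset.sum_range_succ', Finset.mul_sum, pow_succ', Nat.div_div_eq_div_mul,
    mul_assoc, pow_zero, one_mul]

theorem uniformlyComputable_cellCoord {α : Type} [Primcodable α] {k N : Baire → α → ℕ}
    (hk : UniformlyComputable k) (hN : UniformlyComputable N) (n j : ℕ) :
    UniformlyComputable fun p a => cellCoord n j (k p a) (N p a) := by
  have hi : UniformlyComputable fun _ (z : α × ℕ × ℕ) => z.2.1 := .comp .fst .snd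
  have hsum : UniformlyComputable fun _ (z : α × ℕ × ℕ) => z.2.2 := .comp .snd .snd
  have hbit : UniformlyComputable fun p (z : α × ℕ × ℕ) =>
      N p z.1 / (2 * 2 ^ n) ^ z.2.1 / 2 ^ j % 2 :=
    (((hN.comp .fst).div (.pow (.const _) hi)).div (.const _)).mod (.const 2)
  have hrec (k N : ℕ) : cellCoord n j k N =
      Nat.rec 0 (fun i s => s + 2 ^ i * (N / (2 * 2 ^ n) ^ i / 2 ^ j % 2)) k := by
    induction k with
    | zero => rfl
    | succ k ih => rw [cellCoord, Finset.sum_range_succ, ← cellCoord, ih]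
  simpa only [hrec] using
    UniformlyComputable.natRec (.const 0) (hsum.add (.mul (.pow (.const 2) hi) hbit)) hk

/-- When the cube `[-S, S]ⁿ` is cut into `2 ^ (k * n)` equal cubes, this is the least corner of
the one with grid position `cellCoord n · k N`. -/
noncomputable def cellCorner (n S k N : ℕ) : EuclideanSpace ℝ (Fin n) :=
  WithLp.toLp 2 fun j => 2 * S * (cellCoord n j k N / 2 ^ k) - S

theorem cellCorner_apply (n S k N : ℕ) (j : Fin n) :
    cellCorner n S k N j = 2 * S * (cellCoord n j k N / 2 ^ k) - S := rfl

/-- The sum of the edge lengths in the `n` directions, hence a bound for the diameter, of the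
cubes obtained by cutting `[-S, S]ⁿ` into `2 ^ (k * n)` equal cubes. -/
def cellSize (n S k : ℕ) : ℚ := n * (2 * S / 2 ^ k)

theorem tendsto_cellSize (n S : ℕ) :
    Filter.Tendsto (fun k => (cellSize n S k : ℝ)) Filter.atTop (𝓝 0) := by
  have := (tendsto_two_inv_pow.const_mul (2 * S : ℝ)).const_mul (n : ℝ)
  simpa [cellSize, div_eq_mul_inv] using this

theorem cellSize_le_two_inv_pow (n S i : ℕ) :
    (cellSize n S (i + 2 * n * S) : ℝ) ≤ 2⁻¹ ^ i := by
  have h : ((2 * n * S : ℕ) : ℝ) ≤ 2 ^ (2 * n * S) := by exact_mod_cast Nat.lt_two_pow_self.le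
  rw [cellSize, inv_pow, pow_add]
  push_cast at h ⊢
  rw [← mul_div_assoc, inv_eq_one_div, div_le_div_iff₀ (by positivity) (by positivity)]
  nlinarith [show (0 : ℝ) < 2 ^ i by positivity]

theorem uniformlyComputableRat_cellSize {α : Type} [Primcodable α] {S k : Baire → α → ℕ}
    (hS : UniformlyComputable S) (hk : UniformlyComputable k) (n : ℕ) :
    UniformlyComputableRat fun p a => cellSize n (S p a) (k p a) := by
  simpa [cellSize] using (UniformlyComputableRat.const n).mul
    (((UniformlyComputableRat.const 2).mul (.natCast hS)).div_natCast (.pow (.const 2) hk))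

theorem exists_ratPoint_eq_cellCorner {α : Type} [Primcodable α] {S k N : Baire → α → ℕ}
    (hS : UniformlyComputable S) (hk : UniformlyComputable k) (hN : UniformlyComputable N)
    (n : ℕ) : ∃ g : Baire → α → ℕ, UniformlyComputable g ∧
      ∀ p a, ratPoint n (g p a) = cellCorner n (S p a) (k p a) (N p a) := by
  obtain ⟨g, hg, hgr⟩ := exists_ratPoint_eq fun j : Fin n =>
    (((UniformlyComputableRat.const 2).mul (.natCast hS)).mul
      ((UniformlyComputableRat.natCast (uniformlyComputable_cellCoord hk hN n j)).div_natCast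
        (.pow (.const 2) hk))).sub (.natCast hS)
  refine ⟨g, hg, fun p a => PiLp.ext fun j => ?_⟩
  rw [hgr, cellCorner_apply]
  push_cast
  rfl

theorem dist_cellCorner_succ_le {N : ℕ → ℕ} (hN : IsBranch (2 * 2 ^ n) N) (S k : ℕ) :
    dist (cellCorner n S k (N k)) (cellCorner n S (k + 1) (N (k + 1))) ≤
      n * (2 * S) / 2 / 2 ^ k := by
  rw [mul_div_assoc, mul_div_assoc]
  refine dist_le_mul_of_forall_abs_sub_le fun j => ?_
  have hbit : ((N (k + 1) / 2 ^ (j : ℕ) % 2 : ℕ) : ℝ) ≤ 1 := by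
    exact_mod_cast Nat.le_of_lt_succ (Nat.mod_lt _ two_pos)
  have hsub : cellCorner n S k (N k) j - cellCorner n S (k + 1) (N (k + 1)) j =
      -((N (k + 1) / 2 ^ (j : ℕ) % 2 : ℕ) * (2 * S / 2 / 2 ^ k)) := by
    rw [cellCorner_apply, cellCorner_apply, cellCoord_succ, hN, pow_succ]
    push_cast
    field_simp
    ring
  rw [hsub, abs_neg, abs_of_nonneg (by positivity)]
  exact mul_le_of_le_one_left (by positivity) hbit

theorem exists_forall_dist_cellCorner_le {N : ℕ → ℕ} (hN : IsBranch (2 * 2 ^ n) N) (S : ℕ) :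
    ∃ y, ∀ k, dist (cellCorner n S k (N k)) y ≤ cellSize n S k := by
  obtain ⟨y, hy⟩ := cauchySeq_tendsto_of_complete
    (cauchySeq_of_le_geometric_two (dist_cellCorner_succ_le hN S))
  refine ⟨y, fun k => ?_⟩
  simpa [cellSize, mul_div_assoc] using
    dist_le_of_le_geometric_two_of_tendsto (dist_cellCorner_succ_le hN S) hy k

theorem exists_isBranch_cellCoord_eq {A : Fin n → ℕ → ℕ} (hA : ∀ j, IsBranch 2 (A j))
    (hA0 : ∀ j, A j 0 = 0) (m : ℕ) :
    ∃ N : ℕ → ℕ, N 0 = m ∧ IsBranch (2 * 2 ^ n) N ∧ (∀ k, N (k + 1) % (2 * 2 ^ n) < 2 ^ n) ∧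
      ∀ (j : Fin n) (k : ℕ), cellCoord n j k (N k) = A j k := by
  let d (k : ℕ) : ℕ := Nat.ofBits fun j : Fin n => decide (A j (k + 1) % 2 = 1)
  let N (k : ℕ) : ℕ := Nat.rec m (fun i r => 2 * 2 ^ n * r + d i) k
  have hN_succ (k : ℕ) : N (k + 1) = 2 * 2 ^ n * N k + d k := rfl
  have hd (k : ℕ) : d k < 2 ^ n := Nat.ofBits_lt_two_pow _
  have hdB (k : ℕ) : d k < 2 * 2 ^ n := by linarith [hd k]
  have hN : IsBranch (2 * 2 ^ n) N := fun k => by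
    rw [hN_succ, Nat.mul_add_div (by positivity), Nat.div_eq_of_lt (hdB k), add_zero]
  have hbit (j : Fin n) (k : ℕ) : N (k + 1) / 2 ^ (j : ℕ) % 2 = A j (k + 1) % 2 := by
    have h : (N (k + 1)).testBit j = decide (A j (k + 1) % 2 = 1) := by
      rw [hN_succ, ← pow_succ', Nat.testBit_two_pow_mul_add _ (by rw [pow_succ']; exact hdB k),
        if_pos (by omega), Nat.testBit_ofBits_lt _ _ j.2]
    rw [Nat.testBit_eq_decide_div_mod_eq, decide_eq_decide] at h
    omega
  refine ⟨N, rfl, hN, fun k => ?_, fun j k => ?_⟩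
  · rw [hN_succ, Nat.mul_add_mod, Nat.mod_eq_of_lt (hdB k)]
    exact hd k
  · induction k with
    | zero => exact (hA0 j).symm
    | succ k ih => rw [cellCoord_succ, hN, ih, hbit, ← hA j k, Nat.div_add_mod]

theorem exists_isBranch_dist_cellCorner_le {S : ℕ} {y : EuclideanSpace ℝ (Fin n)} (hy : ‖y‖ < S)
    (m : ℕ) : ∃ N : ℕ → ℕ, N 0 = m ∧ IsBranch (2 * 2 ^ n) N ∧
      (∀ k, N (k + 1) % (2 * 2 ^ n) < 2 ^ n) ∧
      ∀ k, dist (cellCorner n S k (N k)) y ≤ cellSize n S k := by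
  have hS : (0 : ℝ) < S := (norm_nonneg y).trans_lt hy
  have hcoord (j : Fin n) : -S < y j ∧ y j < S := abs_lt.1 ((PiLp.norm_apply_le y j).trans_lt hy)
  let u (j : Fin n) : ℝ := (y j + S) / (2 * S)
  have hu0 (j : Fin n) : 0 ≤ u j := div_nonneg (by linarith [hcoord j]) (by positivity)
  have hu1 (j : Fin n) : u j < 1 := (div_lt_one (by positivity)).2 (by linarith [hcoord j])
  have hyu (j : Fin n) : y j + S = 2 * S * u j := (mul_div_cancel₀ _ (by positivity)).symm
  obtain ⟨N, hN0, hN, hdigit, hNA⟩ := exists_isBranch_cellCoord_eq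
    (fun j => isBranch_natFloor two_pos (u j))
    (fun j => Nat.floor_eq_zero.2 (by simpa using hu1 j)) m
  refine ⟨N, hN0, hN, hdigit, fun k => ?_⟩
  rw [cellSize]
  push_cast
  refine dist_le_mul_of_forall_abs_sub_le fun j => ?_
  have hfloor := Nat.floor_le (show 0 ≤ (2 : ℝ) ^ k * u j by have := hu0 j; positivity)
  have hceil := Nat.lt_floor_add_one ((2 : ℝ) ^ k * u j)
  have hsub : cellCorner n S k (N k) j - y j =
      -(2 * S / 2 ^ k * (2 ^ k * u j - ⌊(2 : ℝ) ^ k * u j⌋₊)) := by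
    rw [cellCorner_apply, hNA, Nat.cast_ofNat, eq_sub_of_add_eq (hyu j)]
    field_simp
    ring
  rw [hsub, abs_neg, abs_of_nonneg (mul_nonneg (by positivity) (by linarith))]
  exact mul_le_of_le_one_right (by positivity) (by linarith)

end Cells

/-! ### Approximate projection by closed choice -/

section Certificates

variable {n : ℕ}

theorem ratPoint_zero (n : ℕ) : ratPoint n 0 = 0 := by
  ext j
  simp [ratPoint, ratEnum]

theorem exists_nnratEnum_eq {q : ℚ} (hq : 0 ≤ q) : ∃ m, nnratEnum m = q := by
  obtain ⟨g, -, hg⟩ := (UniformlyComputableRat.const (α := ℕ) q).exists_nnratEnum_eq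
  exact ⟨_, (hg 0 0).trans (max_eq_left hq)⟩

theorem uniformlyDecidable_rejected {α : Type} [Primcodable α] {P B : Baire → Baire}
    {k g : Baire → α → ℕ} {δ r : Baire → α → ℚ} (hP : UniformlyComputable P)
    (hB : UniformlyComputable B) (hk : UniformlyComputable k) (hg : UniformlyComputable g)
    (hδ : UniformlyComputableRat δ) (hr : UniformlyComputableRat r) :
    UniformlyDecidable fun p a =>
      Rejected (P p) (B p) (k p a) (ratPoint n (g p a)) (δ p a) (r p a) := by
  have hball : UniformlyComputable fun p (z : α × ℕ) => B p z.2 := hB.comp .snd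
  have hin := UniformlyDecidable.exists_lt (uniformlyDecidable_dist_ratPoint_lt (n := n)
    hball.unpair_fst (hg.comp .fst) (.sub (.nnratEnum hball.unpair_snd) (hδ.comp .fst))) hk
  have hout := uniformlyDecidable_lt_dist_ratPoint (n := n) (hP.comp hk) hg
    ((hr.add (.two_inv_pow hk)).add hδ)
  convert hin.or hout using 3 with p a
  rw [Rejected]
  push_cast
  rfl

/-- A finite certificate for `q ≤ d(x, A)`, where `p` is a name of `x` and `b` is a name of a
nonempty closed set `A ⊆ ℝⁿ`: the closed ball of radius `q` around `x` lies in the cube `[-S, S]ⁿ`,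
and all cubes of the `t`-th subdivision of the latter are rejected. -/
def InfDistCert (n : ℕ) (p b : Baire) (S t : ℕ) (q : ℝ) : Prop :=
  0 < q → (∀ N < (2 * 2 ^ n) ^ t, Rejected p b t (cellCorner n S t N) (cellSize n S t) q) ∧
    dist (ratPoint n (p t)) 0 < S - q - 2⁻¹ ^ t

theorem uniformlyDecidable_infDistCert {α : Type} [Primcodable α] {P B : Baire → Baire}
    {S t : Baire → α → ℕ} {q : Baire → α → ℚ} (hP : UniformlyComputable P)
    (hB : UniformlyComputable B) (hS : UniformlyComputable S) (ht : UniformlyComputable t)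
    (hq : UniformlyComputableRat q) (n : ℕ) :
    UniformlyDecidable fun p a => InfDistCert n (P p) (B p) (S p a) (t p a) (q p a) := by
  have hS' : UniformlyComputable fun p (z : α × ℕ) => S p z.1 := hS.comp .fst
  have ht' : UniformlyComputable fun p (z : α × ℕ) => t p z.1 := ht.comp .fst
  obtain ⟨g, hg, hcorner⟩ := exists_ratPoint_eq_cellCorner hS' ht' .snd n
  have hcells := UniformlyDecidable.forall_lt (uniformlyDecidable_rejected (n := n) hP hB ht' hg
    (uniformlyComputableRat_cellSize hS' ht' n) (hq.comp .fst)) (.pow (.const (2 * 2 ^ n)) ht)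
  have hcube := uniformlyDecidable_dist_ratPoint_lt (n := n) (hP.comp ht) (.const 0)
    (((UniformlyComputableRat.natCast hS).sub hq).sub (.two_inv_pow ht))
  convert ((UniformlyComputableRat.const 0).lt hq).imp (hcells.and hcube) using 3 with p a
  simp only [InfDistCert, hcorner, ratPoint_zero, Rat.cast_pos]
  push_cast
  rfl

variable {p b : Baire} {x : EuclideanSpace ℝ (Fin n)}
  {A : TopologicalSpace.Closeds (EuclideanSpace ℝ (Fin n))}

theorem InfDistCert.le_infDist {S t : ℕ} {q : ℝ} (h : InfDistCert n p b S t q)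
    (hp : (cauchyRep _).Names p x) (hb : (negRep _).Names b A)
    (hne : (A : Set (EuclideanSpace ℝ (Fin n))).Nonempty) : q ≤ Metric.infDist x A := by
  rcases le_or_gt q 0 with hq | hq
  · exact hq.trans Metric.infDist_nonneg
  obtain ⟨hcells, hcube⟩ := h hq
  refine (Metric.le_infDist hne).2 fun a ha => ?_
  by_contra! hlt
  have hnorm : ‖a‖ < S := by
    rw [← dist_zero_right]
    have hpx : dist (ratPoint n (p t)) x ≤ 2⁻¹ ^ t := dist_pt_le_of_names hp t
    linarith [dist_triangle4 a x (ratPoint n (p t)) 0, dist_comm a x,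
      dist_comm x (ratPoint n (p t))]
  obtain ⟨N, hN0, hN, -, hdist⟩ := exists_isBranch_dist_cellCorner_le hnorm 0
  have hlt' : N t < (2 * 2 ^ n) ^ t :=
    (Nat.div_eq_zero_iff.1 ((hN.div_pow t).trans hN0)).resolve_left (by positivity)
  exact not_rejected_of_dist_le hp hb ha hlt.le (hdist t) (hcells _ hlt')

theorem exists_infDistCert {S : ℕ} {q : ℝ} (hp : (cauchyRep _).Names p x)
    (hb : (negRep _).Names b A) (hq : q < Metric.infDist x A) (hS : dist x 0 + q + 2 < S) :
    ∃ t, InfDistCert n p b S t q := by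
  obtain ⟨t, ht⟩ := (eventually_forall_rejected hp hb (tendsto_cellSize n S) hq).exists
  refine ⟨t, fun _ => ⟨fun N _ => ht _, ?_⟩⟩
  have hpx : dist (ratPoint n (p t)) x ≤ 2⁻¹ ^ t := dist_pt_le_of_names hp t
  have hpow : (2⁻¹ : ℝ) ^ t ≤ 1 := pow_le_one₀ (by norm_num) (by norm_num)
  linarith [dist_triangle (ratPoint n (p t)) x 0]

theorem exists_infDistCert_and_dist_le (hp : (cauchyRep _).Names p x)
    (hb : (negRep _).Names b A) (hne : (A : Set (EuclideanSpace ℝ (Fin n))).Nonempty) {c : ℝ}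
    (hc : 1 < c) : ∃ S q t : ℕ, InfDistCert n p b S t (nnratEnum q) ∧
      ∃ y ∈ A, ‖y‖ < S ∧ dist x y ≤ c * nnratEnum q := by
  by_cases hxA : x ∈ A
  · obtain ⟨S, hS⟩ := exists_nat_gt ‖x‖
    obtain ⟨q, hq⟩ := exists_nnratEnum_eq le_rfl
    exact ⟨S, q, 0, by simp [InfDistCert, hq], x, hxA, hS, by simp [hq]⟩
  · have hpos : 0 < Metric.infDist x A := (A.isClosed.notMem_iff_infDist_pos hne).1 hxA
    obtain ⟨y, hyA, hy⟩ := A.isClosed.exists_infDist_eq_dist hne x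
    obtain ⟨r, hr, hrA⟩ := exists_rat_btwn (div_lt_self hpos hc)
    obtain ⟨q, rfl⟩ := exists_nnratEnum_eq (q := r) (by
      exact_mod_cast ((div_pos hpos (by linarith)).trans hr).le)
    obtain ⟨S, hS⟩ := exists_nat_gt (max ‖y‖ (dist x 0 + nnratEnum q + 2))
    obtain ⟨hyS, hxS⟩ := max_lt_iff.1 hS
    obtain ⟨t, ht⟩ := exists_infDistCert hp hb hrA hxS
    exact ⟨S, q, t, ht, y, hyA, hyS, hy ▸ ((div_lt_iff₀' (by linarith)).1 hr).le⟩

end Certificates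

section ProjectionTree

variable {n : ℕ}

/-- The nodes to be removed from the tree whose root `⟨S, q, t⟩` proposes the `t`-th subdivision of
`[-S, S]ⁿ` as a certificate for `nnratEnum q ≤ d(x, A)` and whose branches with this root describe
points of `[-S, S]ⁿ`, such that the remaining branches describe points `y ∈ A` with
`d(x, y) ≤ c * nnratEnum q` below a valid root. The node with number `N` of level `k` is encoded as
`(k, N)`. -/
def Pruned (n : ℕ) (c : ℚ) (p b : Baire) (z : ℕ × ℕ) : Prop :=
  let root := z.2 / (2 * 2 ^ n) ^ z.1
  let S := root.unpair.1
  let q := nnratEnum root.unpair.2.unpair.1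
  let t := root.unpair.2.unpair.2
  ¬InfDistCert n p b S t q ∨
    Rejected p b z.1 (cellCorner n S z.1 z.2) (cellSize n S z.1) (c * q)

theorem uniformlyDecidable_pruned {P B : Baire → Baire} (hP : UniformlyComputable P)
    (hB : UniformlyComputable B) (n : ℕ) (c : ℚ) :
    UniformlyDecidable fun p => Pruned n c (P p) (B p) := by
  have hroot : UniformlyComputable fun _ (z : ℕ × ℕ) => z.2 / (2 * 2 ^ n) ^ z.1 :=
    .div .snd (.pow (.const _) .fst)
  have hS := hroot.unpair_fst
  have hq := UniformlyComputableRat.nnratEnum hroot.unpair_snd.unpair_fst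
  obtain ⟨g, hg, hcorner⟩ := exists_ratPoint_eq_cellCorner hS .fst .snd n
  unfold Pruned
  simpa only [hcorner, Rat.cast_mul] using
    (uniformlyDecidable_infDistCert hP hB hS hroot.unpair_snd.unpair_snd hq n).not.or
      (uniformlyDecidable_rejected (n := n) hP hB .fst hg
        (uniformlyComputableRat_cellSize hS .fst n) ((UniformlyComputableRat.const c).mul hq))

variable {p b : Baire} {x : EuclideanSpace ℝ (Fin n)}
  {A : TopologicalSpace.Closeds (EuclideanSpace ℝ (Fin n))} {c : ℚ}

theorem exists_isBranch_forall_not_pruned (hp : (cauchyRep _).Names p x)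
    (hb : (negRep _).Names b A) (hne : (A : Set (EuclideanSpace ℝ (Fin n))).Nonempty)
    (hc : 1 < c) : ∃ N, IsBranch (2 * 2 ^ n) N ∧ (∀ k, N (k + 1) % (2 * 2 ^ n) < 2 ^ n) ∧
      ∀ k, ¬Pruned n c p b (k, N k) := by
  obtain ⟨S, q, t, hcert, y, hyA, hyS, hxy⟩ :=
    exists_infDistCert_and_dist_le hp hb hne (c := c) (by exact_mod_cast hc)
  obtain ⟨N, hN0, hN, hdigit, hdist⟩ :=
    exists_isBranch_dist_cellCorner_le hyS (Nat.pair S (Nat.pair q t))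
  refine ⟨N, hN, hdigit, fun k => ?_⟩
  simp only [Pruned, hN.div_pow, hN0, Nat.unpair_pair, not_or, not_not]
  exact ⟨hcert, not_rejected_of_dist_le hp hb hyA hxy (hdist k)⟩

theorem exists_approxProj_of_forall_not_pruned (hp : (cauchyRep _).Names p x)
    (hb : (negRep _).Names b A) (hne : (A : Set (EuclideanSpace ℝ (Fin n))).Nonempty)
    (hc : 0 ≤ c) {N : ℕ → ℕ} (hN : IsBranch (2 * 2 ^ n) N)
    (h : ∀ k, ¬Pruned n c p b (k, N k)) :
    ∃ y ∈ A, dist x y ≤ c * Metric.infDist x A ∧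
      ∀ k, dist (cellCorner n (N 0).unpair.1 k (N k)) y ≤ cellSize n (N 0).unpair.1 k := by
  simp only [Pruned, hN.div_pow, not_or, not_not] at h
  obtain ⟨y, hy⟩ := exists_forall_dist_cellCorner_le hN (N 0).unpair.1
  obtain ⟨hyA, hxy⟩ :=
    mem_and_dist_le_of_forall_not_rejected hp hb (tendsto_cellSize n _) hy fun k => (h k).2
  refine ⟨y, hyA, hxy.trans ?_, hy⟩
  gcongr
  exact (h 0).1.le_infDist hp hb hne

theorem exists_uniformlyComputable_names_of_dist_cellCorner_le (n : ℕ) :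
    ∃ D : Baire → Baire, UniformlyComputable D ∧ ∀ (N : ℕ → ℕ) (y : EuclideanSpace ℝ (Fin n)),
      (∀ k, dist (cellCorner n (N 0).unpair.1 k (N k)) y ≤ cellSize n (N 0).unpair.1 k) →
        (cauchyRep _).Names (D N) y := by
  have hS : UniformlyComputable fun N (_ : ℕ) => (N 0).unpair.1 :=
    .unpair_fst (.oracle (.const 0))
  have hlevel : UniformlyComputable fun N i => i + 1 + 2 * n * (N 0).unpair.1 :=
    .add (.add .id (.const 1)) (.mul (.const (2 * n)) hS)
  obtain ⟨D, hD, hcorner⟩ := exists_ratPoint_eq_cellCorner hS hlevel (.oracle hlevel) n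
  refine ⟨D, hD, fun N y hy => cauchyRep_names_of_dist_le fun i => ?_⟩
  change dist (ratPoint n (D N i)) y ≤ 2⁻¹ ^ (i + 1)
  rw [hcorner]
  exact (hy _).trans (cellSize_le_two_inv_pow n _ (i + 1))

theorem approxNegProj_strongReducible_closedChoice_real {ε : ℝ} (hε : 0 < ε) (n : ℕ) :
    StrongReducible (approxNegProj (EuclideanSpace ℝ (Fin n)) ε) (closedChoice ℝ) := by
  obtain ⟨c, hc, hcε⟩ := exists_rat_btwn (lt_add_of_pos_right (1 : ℝ) hε)
  obtain ⟨D, hD, hDnames⟩ := exists_uniformlyComputable_names_of_dist_cellCorner_le n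
  have heven : UniformlyComputable fun p i => p (2 * i) := .oracle (.mul (.const 2) .id)
  have hodd : UniformlyComputable fun p i => p (2 * i + 1) :=
    .oracle (.add (.mul (.const 2) .id) (.const 1))
  refine strongReducible_closedChoice_real_of_branches (Nat.two_pow_pos n)
    (uniformlyDecidable_pruned heven hodd n c) hD ?_ ?_
  · rintro p ⟨x, A⟩ ⟨hp, hb⟩ ⟨y, hyA, -⟩
    exact exists_isBranch_forall_not_pruned hp hb ⟨y, hyA⟩ (by exact_mod_cast hc)
  · rintro p ⟨x, A⟩ ⟨hp, hb⟩ ⟨y, hyA, -⟩ N hN hNP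
    obtain ⟨z, hzA, hxz, hz⟩ := exists_approxProj_of_forall_not_pruned hp hb ⟨y, hyA⟩
      (by exact_mod_cast zero_le_one.trans hc.le) hN hNP
    exact ⟨z, ⟨hzA, hxz.trans (mul_le_mul_of_nonneg_right hcε.le Metric.infDist_nonneg)⟩,
      hDnames N z hz⟩

end ProjectionTree

/-! ### Closed choice by approximate projection -/

section Interleave

/-- The pair of the infinite inputs `p` and `q`, in the encoding used by `Representation.prod`. -/
def interleave (p q : Baire) : Baire := fun i => bif i.bodd then q i.div2 else p i.div2

theorem prod_names_interleave {X Y : Type} {δ : Representation X} {δ' : Representation Y}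
    {p q : Baire} {x : X} {y : Y} (hp : δ.Names p x) (hq : δ'.Names q y) :
    (δ.prod δ').Names (interleave p q) (x, y) := by
  have heven : (fun i => interleave p q (2 * i)) = p := funext fun i => by
    simp [interleave, Nat.div2_val]
  have hodd : (fun i => interleave p q (2 * i + 1)) = q := funext fun i => by
    simp [interleave, Nat.div2_val]
  exact ⟨by simpa only [heven], by simpa only [hodd]⟩

theorem UniformlyComputable.interleave {F G : Baire → Baire} (hF : UniformlyComputable F)
    (hG : UniformlyComputable G) : UniformlyComputable fun p => interleave (F p) (G p) := by
  have hhalf : UniformlyComputable fun _ (i : ℕ) => i.div2 := .of_primrec Primrec.nat_div2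
  exact .cond (.of_primrec Primrec.nat_bodd) (hG.comp hhalf) (hF.comp hhalf)

end Interleave

section Slabs

/-- An index, with respect to `ratEnum`, of the `j`-th coordinate of the `k`-th rational point. -/
def ratCoord (j k : ℕ) : ℕ := (Denumerable.ofNat (List ℕ) k).getD j 0

theorem UniformlyComputable.ratCoord {α : Type} [Primcodable α] {F : Baire → α → ℕ} (j : ℕ)
    (hF : UniformlyComputable F) : UniformlyComputable fun p a => ratCoord j (F p a) :=
  .map (f := Weih.ratCoord j)
    ((Primrec.list_getD 0).comp (Primrec.ofNat (List ℕ)) (.const j)) hF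

/-- The `b`-th basic ball of a Euclidean space is recognized to lie in the slab of those points
whose `j`-th coordinate belongs to the `c`-th basic ball of `ℝ`. -/
def SlabContains (j c b : ℕ) : Prop :=
  |ratEnum (ratCoord j b.unpair.1) - ratEnum c.unpair.1| <
    nnratEnum c.unpair.2 - nnratEnum b.unpair.2

theorem uniformlyDecidable_slabContains {α : Type} [Primcodable α] {F G : Baire → α → ℕ} (j : ℕ)
    (hF : UniformlyComputable F) (hG : UniformlyComputable G) :
    UniformlyDecidable fun p a => SlabContains j (F p a) (G p a) := by
  have hcenter := (UniformlyComputableRat.ratEnum (hG.unpair_fst.ratCoord j)).sub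
    (.ratEnum hF.unpair_fst)
  have hradius := (UniformlyComputableRat.nnratEnum hF.unpair_snd).sub (.nnratEnum hG.unpair_snd)
  simpa only [SlabContains, abs_lt, zero_sub] using
    (((UniformlyComputableRat.const 0).sub hradius).lt hcenter).and (hcenter.lt hradius)

variable {n : ℕ}

theorem coord_mem_basicBall_iff (j : Fin n) (c : ℕ) (y : EuclideanSpace ℝ (Fin n)) :
    y j ∈ (basicBall c : Set ℝ) ↔
      ∃ b, SlabContains j c b ∧ y ∈ (basicBall b : Set (EuclideanSpace ℝ (Fin n))) := by
  have hslab (b : ℕ) : SlabContains j c b ↔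
      dist (ratPoint n b.unpair.1 j) (ratEnum c.unpair.1) <
        nnratEnum c.unpair.2 - nnratEnum b.unpair.2 := by
    change _ ↔ |(ratEnum (ratCoord j b.unpair.1) : ℝ) - ratEnum c.unpair.1| < _
    exact_mod_cast Iff.rfl
  have hc : y j ∈ (basicBall c : Set ℝ) ↔
      dist (y j) (ratEnum c.unpair.1) < nnratEnum c.unpair.2 := Iff.rfl
  have hb (b : ℕ) : y ∈ (basicBall b : Set (EuclideanSpace ℝ (Fin n))) ↔
      dist y (ratPoint n b.unpair.1) < nnratEnum b.unpair.2 := Iff.rfl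
  simp only [hslab, hc, hb]
  constructor
  · intro h
    obtain ⟨s, hs0, hs⟩ := exists_rat_btwn (half_pos (sub_pos.2 h))
    obtain ⟨m, rfl⟩ := exists_nnratEnum_eq (q := s) (by exact_mod_cast hs0.le)
    obtain ⟨k, hk⟩ := (ratPoint_dense n).exists_dist_lt y hs0
    refine ⟨Nat.pair k m, ?_, by simpa only [Nat.unpair_pair] using hk⟩
    simp only [Nat.unpair_pair]
    linarith [PiLp.dist_apply_le y (ratPoint n k) j,
      dist_triangle_left (ratPoint n k j) (ratEnum c.unpair.1 : ℝ) (y j)]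
  · rintro ⟨b, hcb, hby⟩
    linarith [PiLp.dist_apply_le y (ratPoint n b.unpair.1) j,
      dist_triangle (y j) (ratPoint n b.unpair.1 j) (ratEnum c.unpair.1)]

open Classical in
/-- A name of the closed set of all points whose `j`-th coordinate belongs to the closed set named
by `p`: it lists the balls recognized to lie in a slab that `p` lists, and the empty ball `0`. -/
noncomputable def slabName (j : ℕ) (p : Baire) : Baire := fun e =>
  if SlabContains j (p e.unpair.1) e.unpair.2 then e.unpair.2 else 0

theorem uniformlyComputable_slabName (j : ℕ) : UniformlyComputable (slabName j) :=
  (uniformlyDecidable_slabContains j (.oracle (.unpair_fst .id)) (.unpair_snd .id)).ite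
    (.unpair_snd .id) (.const 0)

/-- The closed set of all points of `ℝⁿ` whose `j`-th coordinate belongs to `A`. -/
def coordPreimage (j : Fin n) (A : TopologicalSpace.Closeds ℝ) :
    TopologicalSpace.Closeds (EuclideanSpace ℝ (Fin n)) :=
  ⟨(fun y => y j) ⁻¹' A, A.isClosed.preimage (by fun_prop)⟩

theorem negRep_names_slabName (j : Fin n) {p : Baire} {A : TopologicalSpace.Closeds ℝ}
    (hp : (negRep ℝ).Names p A) : (negRep _).Names (slabName j p) (coordPreimage j A) := by
  have hempty : (basicBall 0 : Set (EuclideanSpace ℝ (Fin n))) = ∅ := by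
    simp [basicBall, nnratEnum]
  have hp' : (A : Set ℝ) = (⋃ i, basicBall (p i))ᶜ := hp
  change (fun y : EuclideanSpace ℝ (Fin n) => y j) ⁻¹' (A : Set ℝ) = _
  rw [hp', Set.preimage_compl, compl_inj_iff]
  ext y
  simp only [Set.mem_preimage, Set.mem_iUnion, coord_mem_basicBall_iff]
  constructor
  · rintro ⟨i, b, hb, hy⟩
    exact ⟨Nat.pair i b, by rwa [slabName, Nat.unpair_pair, if_pos hb]⟩
  · rintro ⟨e, he⟩
    by_cases h : SlabContains j (p e.unpair.1) e.unpair.2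
    · exact ⟨_, _, h, by simpa only [slabName, if_pos h] using he⟩
    · simp [slabName, h, hempty] at he

theorem cauchyRep_names_ratCoord (j : Fin n) {q : Baire} {y : EuclideanSpace ℝ (Fin n)}
    (hq : (cauchyRep _).Names q y) : (cauchyRep ℝ).Names (fun i => ratCoord j (q i)) (y j) :=
  ⟨fun i k hik => (PiLp.dist_apply_le (ratPoint n (q i)) (ratPoint n (q k)) j).trans (hq.1 i k hik),
    ((EuclideanSpace.proj j).continuous.tendsto y).comp hq.2⟩

end Slabs

theorem exists_approxProj {X : Type*} [MetricSpace X] [ProperSpace X] {ε : ℝ} (hε : 0 ≤ ε)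
    {A : Set X} (hA : IsClosed A) (hne : A.Nonempty) (x : X) :
    ∃ y ∈ A, dist x y ≤ (1 + ε) * Metric.infDist x A := by
  obtain ⟨y, hyA, hy⟩ := hA.exists_infDist_eq_dist hne x
  exact ⟨y, hyA, hy.symm.le.trans (le_mul_of_one_le_left Metric.infDist_nonneg (by linarith))⟩

theorem closedChoice_real_strongReducible_approxNegProj {ε : ℝ} (hε : 0 ≤ ε) {n : ℕ} (hn : 1 ≤ n) :
    StrongReducible (closedChoice ℝ) (approxNegProj (EuclideanSpace ℝ (Fin n)) ε) := by
  let j : Fin n := ⟨0, hn⟩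
  have hpoint : (cauchyRep (EuclideanSpace ℝ (Fin n))).Names (fun _ => 0) (ratPoint n 0) :=
    ⟨fun i k _ => by simp, tendsto_const_nhds⟩
  refine strongReducible_of_uniformlyComputable (.ratCoord j (.oracle .id))
    (.interleave (.const 0) (uniformlyComputable_slabName j)) ?_
  rintro p (A : TopologicalSpace.Closeds ℝ) hp ⟨a, ha⟩
  refine ⟨_, prod_names_interleave hpoint (negRep_names_slabName j hp), ?_, ?_⟩
  · have hne : (coordPreimage j A : Set (EuclideanSpace ℝ (Fin n))).Nonempty :=
      ⟨WithLp.toLp 2 fun _ => a, ha⟩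
    exact exists_approxProj hε (coordPreimage j A).isClosed hne _
  · rintro (y : EuclideanSpace ℝ (Fin n)) ⟨hyA, -⟩ q hq
    exact ⟨y j, hyA, cauchyRep_names_ratCoord j hq⟩

end Weih

theorem mainTheorem7 (ε : ℝ) (hε : 0 < ε) (n : ℕ) (hn : 1 ≤ n) :
    Weih.StrongEquiv (Weih.approxNegProj (EuclideanSpace ℝ (Fin n)) ε)
      (Weih.closedChoice ℝ) :=
  ⟨Weih.approxNegProj_strongReducible_closedChoice_real hε n,
    Weih.closedChoice_real_strongReducible_approxNegProj hε.le hn⟩
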